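/- Let $n,k\ge 1$ be integers. A cake cutting instance with $n$ players consists of continuous non-negative densities $d_1,\dots,d_n$ on the cake $[0,1]$ with $\int_0^1 d_i=1$; player $i$ values $S\subseteq[0,1]$ at $V_i(S)=\int_S d_i$. Let $I(n)$ be the set of these instances. For $j\ge1$, $\mathrm{Allocations}_f(j)(I)$ is the set of all families $(A_1,\dots,A_n)$ of pairwise disjoint portions, each a union of at most $j$ disjoint intervals of $[0,1]$ (possibly empty), that are envy-free: $V_i(A_i)\ge V_i(A_l)$ for all $i,l$. The egalitarian welfare of $A$ is $\mathrm{EW}(A)=\min_i V_i(A_i)$. Put $$\tau(I)=\frac{\max_{A\in \mathrm{Allocations}_f(k)(I)}\mathrm{EW}(A)}{\max_{A\in \mathrm{Allocations}_f(1)(I)}\mathrm{EW}(A)},\qquad POIE_f(n,k)=\sup_{I\in I(n)}\tau(I).$$ **Theorem 3.22 (POIE with fairness).** For every instance, both maxima exist and the denominator is positive; the supremum is finite; and $$POIE_f(n,k)\ \begin{cases}\ \ge k & \text{if } k\le n,\\ \ =n & \text{if } k>n.\end{cases}$$ Moreover, some instance $I\in I(n)$ has $\tau(I)\ge k$ if $k\le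 n$, and some instance has $\tau(I)=n$ if $k>n$. All this holds both if the whole cake has to be allocated, $\bigcup_i A_i=[0,1]$, and if part of it may be left unallocated. -/

import Mathlib

open MeasureTheory

noncomputable section

namespace CakeCutting

/-- A cake cutting instance with `n` players: the cake is the interval `[0,1]`, and every player
has a continuous, non-negative value density on the cake of total value `1`. -/
structure Instance (n : ℕ) where
  density : Fin n → ℝ → ℝ
  continuousOn : ∀ i, ContinuousOn (density i) (Set.Icc 0 1)
  nonneg : ∀ i, ∀ x ∈ Set.Icc (0 : ℝ) 1, 0 ≤ density i x
  normalized : ∀ i, ∫ x in Set.Icc (0 : ℝ) 1, density i x = 1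

/-- The value `V_i(S)` of the part `S` of the cake to player `i`. -/
def Instance.value {n : ℕ} (I : Instance n) (i : Fin n) (S : Set ℝ) : ℝ :=
  ∫ x in S, I.density i x

/-- `S` is a union of at most `k` pairwise disjoint intervals of the cake. The order-connected
subsets of `ℝ` are exactly the intervals (open, closed or half-open, possibly degenerate);
empty ones are allowed, which gives "at most". -/
def IsPortion (k : ℕ) (S : Set ℝ) : Prop :=
  ∃ J : Fin k → Set ℝ,
    (∀ m, (J m).OrdConnected ∧ J m ⊆ Set.Icc 0 1) ∧
    (∀ m m', m ≠ m' → Disjoint (J m) (J m')) ∧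
    S = ⋃ m, J m

/-- `A` is an allocation giving each of the `n` players at most `k` disjoint pieces. If
`freeDisposal` is `true`, parts of the cake may be left unallocated; if it is `false`, the whole
cake has to be allocated. -/
structure IsAllocation (freeDisposal : Bool) {n : ℕ} (k : ℕ) (A : Fin n → Set ℝ) : Prop where
  portion : ∀ i, IsPortion k (A i)
  disjoint : ∀ i j, i ≠ j → Disjoint (A i) (A j)
  whole : freeDisposal = false → ⋃ i, A i = Set.Icc 0 1

/-- No player prefers the portion of another player to their own. -/
def Instance.EnvyFree {n : ℕ} (I : Instance n) (A : Fin n → Set ℝ) : Prop :=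
  ∀ i j, I.value i (A j) ≤ I.value i (A i)

/-- The set of envy-free allocations with at most `k` disjoint pieces per player. -/
def Instance.allocationsF {n : ℕ} (I : Instance n) (freeDisposal : Bool) (k : ℕ) :
    Set (Fin n → Set ℝ) :=
  {A | IsAllocation freeDisposal k A ∧ I.EnvyFree A}

/-- Egalitarian welfare: the smallest utility of a player. -/
def Instance.egalitarianWelfare {n : ℕ} (I : Instance n) (A : Fin n → Set ℝ) : ℝ :=
  ⨅ i, I.value i (A i)

/-- The optimal egalitarian welfare over envy-free allocations with at most `k` pieces each. -/
def Instance.optEgalitarianF {n : ℕ} (I : Instance n) (freeDisposal : Bool) (k : ℕ) : ℝ :=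
  sSup (I.egalitarianWelfare '' I.allocationsF freeDisposal k)

/-- The gain in optimal egalitarian welfare, subject to envy-freeness, when each player may get
up to `k` pieces instead of one. -/
def Instance.gainEF {n : ℕ} (I : Instance n) (freeDisposal : Bool) (k : ℕ) : ℝ :=
  I.optEgalitarianF freeDisposal k / I.optEgalitarianF freeDisposal 1

/-- The egalitarian price of indivisibility with envy-freeness: the supremum of the gain over all
instances with `n` players. -/
def POIEf (freeDisposal : Bool) (n k : ℕ) : ℝ :=
  ⨆ I : Instance n, I.gainEF freeDisposal k

end CakeCutting

end

/-! Upper bound: every instance has an envy-free division of the whole cake into one interval per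
player. Each player weakly prefers their own interval to the others, so it is worth at least the
average `1/n`, while no portion is worth more than `1`. Hence the denominator of a gain is at least
`1/n`, the numerator is at most `1`, and the gain is at most `n`.

Lower bound: for `m ≤ n` cut the cake into `2n - 1` cells. Player `0` values `m` even cells equally,
and each other player values a single odd cell. With `m` pieces everybody can get their full value.
With one piece, player `0` either stays within one valued cell, worth `1/m`, or swallows a cell that
is all another player wants. Taking `m = k` or `m = n` gives the two cases
(`exists_instance_le_gainEF`).

The hard ingredient is the envy-free division (`exists_envyFree_cuts`). A parity argument in the
style of Scarf gives a rainbow dominant set of grid points of the simplex of cuts; refining the grid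
yields a Knaster–Kuratowski–Mazurkiewicz lemma. Applied to weights supported on almost best pieces,
it produces a doubly stochastic matrix, and Birkhoff's theorem extracts an assignment.

The maxima exist because, up to boundary points of measure zero, allocations are parametrised by a
compact set of endpoints on which values are continuous. -/

noncomputable section

namespace CakeCutting

/-! ### Dominant sets and a parity argument -/

section Scarf

variable {X ι : Type*}

/-- `σ` is dominant for the rankings `r i` if no element beats the minimum of `σ` in all of them. -/
def Dominant (r : ι → X → ℕ) (σ : Finset X) : Prop :=
  ∀ y, ∃ i, ∀ x ∈ σ, r i y ≤ r i x

theorem Dominant.mono {r : ι → X → ℕ} {σ τ : Finset X} (h : Dominant r σ) (hτ : τ ⊆ σ) :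
    Dominant r τ := fun y => by
  obtain ⟨i, hi⟩ := h y
  exact ⟨i, fun x hx => hi x (hτ hx)⟩

variable [DecidableEq X] [Fintype ι] [DecidableEq ι]

open Classical in
/-- A dominant set of one element less than the number of rankings extends in exactly two ways. -/
theorem card_extensions_eq_two [Fintype X] {r : ι → X → ℕ} (hr : ∀ i, Function.Injective (r i))
    {τ : Finset X} (hcard : τ.card + 1 = Fintype.card ι) (hne : τ.Nonempty) (hτ : Dominant r τ)
    (hM : ∀ a, ∃ y, ∀ i, i ≠ a → ∃ x ∈ τ, r i x < r i y) :
    (Finset.univ.filter fun x => x ∉ τ ∧ Dominant r (insert x τ)).card = 2 := by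
  -- Dominance makes every element of `τ` the minimum of `τ` in some ranking. There is one ranking
  -- more than elements, so exactly two rankings share their minimum; the two extensions belong to
  -- these.
  have hm : ∀ i, ∃ t ∈ τ, ∀ x ∈ τ, r i t ≤ r i x := fun i => τ.exists_min_image (r i) hne
  choose m hmτ hmin using hm
  have eq_m : ∀ i, ∀ t ∈ τ, (∀ x ∈ τ, r i t ≤ r i x) → t = m i := fun i t ht h =>
    hr i (le_antisymm (h _ (hmτ i)) (hmin i t ht))
  have hsurj : ∀ t ∈ τ, ∃ i, m i = t := fun t ht => by
    obtain ⟨i, hi⟩ := hτ t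
    exact ⟨i, (eq_m i t ht hi).symm⟩
  obtain ⟨i₁, -, i₂, -, h12, hm12⟩ : ∃ i₁ ∈ (Finset.univ : Finset ι), ∃ i₂ ∈ (Finset.univ : Finset ι),
      i₁ ≠ i₂ ∧ m i₁ = m i₂ :=
    Finset.exists_ne_map_eq_of_card_lt_of_maps_to (t := τ)
      (by rw [Finset.card_univ]; omega) (fun i _ => hmτ i)
  -- the elements not dominated when the ranking `a` is ignored
  have hx : ∀ a, ∃ x, (∀ i, i ≠ a → r i (m i) < r i x) ∧
      ∀ y, (∀ i, i ≠ a → r i (m i) < r i y) → r a y ≤ r a x := fun a => by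
    obtain ⟨y, hy⟩ := hM a
    have : (Finset.univ.filter fun y => ∀ i, i ≠ a → r i (m i) < r i y).Nonempty :=
      ⟨y, by
        simp only [Finset.mem_filter, Finset.mem_univ, true_and]
        intro i hi
        obtain ⟨x, hx, hlt⟩ := hy i hi
        exact (hmin i x hx).trans_lt hlt⟩
    obtain ⟨x, hx, hmax⟩ := Finset.exists_max_image _ (r a) this
    simp only [Finset.mem_filter, Finset.mem_univ, true_and] at hx hmax
    exact ⟨x, hx, hmax⟩
  choose e heM hemax using hx
  have key : ∀ a a', a ≠ a' → m a = m a' → e a ∉ τ ∧ Dominant r (insert (e a) τ) := by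
    intro a a' haa hma
    constructor
    · intro hmem
      obtain ⟨j, hj⟩ := hsurj _ hmem
      by_cases hja : j = a
      · have h1 := heM a a' haa.symm
        rw [← hma, ← hja, hj, hja] at h1
        exact lt_irrefl _ h1
      · have h1 := heM a j hja
        rw [hj] at h1
        exact lt_irrefl _ h1
    · intro y
      by_cases hy : ∀ i, i ≠ a → r i (m i) < r i y
      · have h1 : r a (e a) ≤ r a (m a) := by
          obtain ⟨i, hi⟩ := hτ (e a)
          by_cases hia : i = a
          · subst hia; exact hi _ (hmτ _)
          · exact absurd (hi _ (hmτ i)) (not_le.2 (heM a i hia))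
        refine ⟨a, fun x hx => ?_⟩
        rcases Finset.mem_insert.1 hx with rfl | hx
        · exact hemax a y hy
        · exact ((hemax a y hy).trans h1).trans (hmin a x hx)
      · push Not at hy
        obtain ⟨i, hia, hi⟩ := hy
        refine ⟨i, fun x hx => ?_⟩
        rcases Finset.mem_insert.1 hx with rfl | hx
        · exact hi.trans (heM a i hia).le
        · exact hi.trans (hmin i x hx)
  have hne12 : e i₁ ≠ e i₂ := by
    intro h
    obtain ⟨i, hi⟩ := hτ (e i₁)
    have h1 := hi _ (hmτ i)
    by_cases hi1 : i = i₁
    · have h2 := heM i₂ i (hi1 ▸ h12)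
      rw [← h] at h2
      omega
    · have h2 := heM i₁ i hi1
      omega
  have hset : (Finset.univ.filter fun x => x ∉ τ ∧ Dominant r (insert x τ)) = {e i₁, e i₂} := by
    ext x
    simp only [Finset.mem_filter, Finset.mem_univ, true_and, Finset.mem_insert,
      Finset.mem_singleton]
    constructor
    · rintro ⟨hxτ, hdom⟩
      obtain ⟨a, ha⟩ := hdom x
      -- As `x` is lowest in ranking `a`, the elements of `τ` are the minima in the remaining
      -- rankings, one each. So `x` beats the minimum of `τ` everywhere but in `a`, and dominance
      -- forces `x = e a`.
      have hf : ∀ t : τ, ∃ i, m i = t ∧ r i t < r i x := fun t => by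
        obtain ⟨i, hi⟩ := hdom t
        refine ⟨i, (eq_m i t t.2 fun x hx => hi x (Finset.mem_insert_of_mem hx)).symm, ?_⟩
        refine lt_of_le_of_ne (hi x (Finset.mem_insert_self _ _)) fun h => hxτ ?_
        rw [← hr i h]; exact t.2
      choose f hfm hfx using hf
      have hfinj : Function.Injective f := fun s t h => Subtype.ext (by rw [← hfm s, ← hfm t, h])
      have hfa : ∀ t, f t ≠ a := fun t h => by
        have h1 := hfx t
        rw [h] at h1
        exact absurd (ha t (Finset.mem_insert_of_mem t.2)) (not_le.2 h1)
      have himg : Finset.univ.image f = Finset.univ.erase a := by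
        apply Finset.eq_of_subset_of_card_le
        · intro i hi
          obtain ⟨t, -, rfl⟩ := Finset.mem_image.1 hi
          exact Finset.mem_erase.2 ⟨hfa t, Finset.mem_univ _⟩
        · rw [Finset.card_image_of_injective _ hfinj, Finset.card_erase_of_mem (Finset.mem_univ _)]
          simp only [Finset.card_univ, Fintype.card_coe]
          omega
      have hpre : ∀ i, i ≠ a → ∃ t, f t = i := fun i hi => by
        have : i ∈ Finset.univ.image f := by
          rw [himg]; exact Finset.mem_erase.2 ⟨hi, Finset.mem_univ _⟩
        obtain ⟨t, -, h⟩ := Finset.mem_image.1 this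
        exact ⟨t, h⟩
      have hxM : ∀ i, i ≠ a → r i (m i) < r i x := fun i hi => by
        obtain ⟨t, rfl⟩ := hpre i hi
        rw [hfm]; exact hfx t
      have hxe : x = e a := by
        obtain ⟨i, hi⟩ := hdom (e a)
        have hia : i = a := by
          by_contra hia
          exact absurd (hi _ (Finset.mem_insert_of_mem (hmτ i))) (not_le.2 (heM a i hia))
        subst hia
        exact hr i (le_antisymm (hemax i x hxM) (hi x (Finset.mem_insert_self _ _)))
      by_cases h1 : i₁ = a
      · left; rw [h1]; exact hxe
      by_cases h2 : i₂ = a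
      · right; rw [h2]; exact hxe
      obtain ⟨t₁, ht₁⟩ := hpre i₁ h1
      obtain ⟨t₂, ht₂⟩ := hpre i₂ h2
      exfalso
      apply h12
      have : t₁ = t₂ := Subtype.ext (by rw [← hfm t₁, ← hfm t₂, ht₁, ht₂, hm12])
      rw [← ht₁, ← ht₂, this]
    · rintro (rfl | rfl)
      · exact key _ _ h12 hm12
      · exact key _ _ h12.symm hm12.symm
  rw [hset, Finset.card_pair hne12]

/-- The number of ways to delete an element so as to keep all colours but `i₀` is odd exactly for
rainbow sets. -/
theorem odd_card_deletions_iff (c : X → ι) (i₀ : ι) {σ : Finset X}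
    (hcard : σ.card = Fintype.card ι) :
    Odd (σ.filter fun x => (σ.erase x).image c = Finset.univ.erase i₀).card ↔
      σ.image c = Finset.univ := by
  constructor
  · intro hodd
    -- A set that is not rainbow has no such deletion or exactly two: if deleting `x₀` works, its
    -- colour occurs exactly once more, at `x₁`, and only these two may be deleted.
    by_contra hnot
    obtain ⟨x₀, hx₀⟩ : (σ.filter fun x => (σ.erase x).image c = Finset.univ.erase i₀).Nonempty := by
      rw [← Finset.card_pos]; exact hodd.pos
    obtain ⟨hx₀σ, himg⟩ := Finset.mem_filter.1 hx₀
    have hcx : c x₀ ≠ i₀ := by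
      intro h
      apply hnot
      rw [← Finset.insert_erase hx₀σ, Finset.image_insert, himg, h,
        Finset.insert_erase (Finset.mem_univ _)]
    have hinj : Set.InjOn c (σ.erase x₀ : Finset X) := by
      rw [← Finset.card_image_iff, himg, Finset.card_erase_of_mem (Finset.mem_univ _),
        Finset.card_erase_of_mem hx₀σ, hcard, Finset.card_univ]
    obtain ⟨x₁, hx₁, hcx₁⟩ : ∃ x₁ ∈ σ.erase x₀, c x₁ = c x₀ := by
      rw [← Finset.mem_image, himg]
      exact Finset.mem_erase.2 ⟨hcx, Finset.mem_univ _⟩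
    obtain ⟨hne, hx₁σ⟩ := Finset.mem_erase.1 hx₁
    have hset : (σ.filter fun x => (σ.erase x).image c = Finset.univ.erase i₀) = {x₀, x₁} := by
      ext x
      simp only [Finset.mem_filter, Finset.mem_insert, Finset.mem_singleton]
      constructor
      · rintro ⟨hx, hxi⟩
        by_contra hcon
        push Not at hcon
        have hxmem : c x ∈ (σ.erase x).image c := by
          rw [hxi, ← himg]
          exact Finset.mem_image_of_mem _ (Finset.mem_erase.2 ⟨hcon.1, hx⟩)
        obtain ⟨y, hy, hyx⟩ := Finset.mem_image.1 hxmem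
        obtain ⟨hyne, hyσ⟩ := Finset.mem_erase.1 hy
        by_cases hy0 : y = x₀
        · subst hy0
          exact hcon.2 (hinj (Finset.mem_erase.2 ⟨hcon.1, hx⟩) hx₁ (by rw [hcx₁, hyx]))
        · exact hyne (hinj (Finset.mem_erase.2 ⟨hy0, hyσ⟩) (Finset.mem_erase.2 ⟨hcon.1, hx⟩) hyx)
      · rintro (rfl | rfl)
        · exact ⟨hx₀σ, himg⟩
        · refine ⟨hx₁σ, ?_⟩
          rw [← himg]
          ext j
          simp only [Finset.mem_image, Finset.mem_erase]
          constructor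
          · rintro ⟨y, ⟨h1, h2⟩, rfl⟩
            by_cases h : y = x₀
            · exact ⟨x, ⟨hne, hx₁σ⟩, by rw [h, hcx₁]⟩
            · exact ⟨y, ⟨h, h2⟩, rfl⟩
          · rintro ⟨y, ⟨h1, h2⟩, rfl⟩
            by_cases h : y = x
            · exact ⟨x₀, ⟨hne.symm, hx₀σ⟩, by rw [h, hcx₁]⟩
            · exact ⟨y, ⟨h, h2⟩, rfl⟩
    rw [hset, Finset.card_pair hne.symm] at hodd
    exact absurd hodd (by decide)
  · intro himg
    have hinj : Set.InjOn c σ := by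
      rw [← Finset.card_image_iff, himg, hcard, Finset.card_univ]
    obtain ⟨x₀, hx₀, hc⟩ : ∃ x ∈ σ, c x = i₀ := by
      rw [← Finset.mem_image, himg]; exact Finset.mem_univ _
    have hset : (σ.filter fun x => (σ.erase x).image c = Finset.univ.erase i₀) = {x₀} := by
      ext x
      simp only [Finset.mem_filter, Finset.mem_singleton]
      constructor
      · rintro ⟨hx, hxi⟩
        by_contra hne
        have : i₀ ∈ (σ.erase x).image c :=
          Finset.mem_image.2 ⟨x₀, Finset.mem_erase.2 ⟨Ne.symm hne, hx₀⟩, hc⟩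
        rw [hxi] at this
        exact Finset.notMem_erase _ _ this
      · rintro rfl
        refine ⟨hx₀, ?_⟩
        ext j
        simp only [Finset.mem_image, Finset.mem_erase, Finset.mem_univ, and_true]
        constructor
        · rintro ⟨y, ⟨h1, h2⟩, rfl⟩ h
          exact h1 (hinj h2 hx₀ (h.trans hc.symm))
        · intro hj
          obtain ⟨y, hy, rfl⟩ : ∃ y ∈ σ, c y = j := by
            rw [← Finset.mem_image, himg]; exact Finset.mem_univ _
          exact ⟨y, ⟨fun h => hj (by rw [h, hc]), hy⟩, rfl⟩
    rw [hset]; simp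

/-- Scarf's lemma: with slack elements `z i` of the matching colours, every colouring admits a
rainbow dominant set. -/
theorem exists_rainbow_dominant [Fintype X] [Nonempty ι] {r : ι → X → ℕ} (hr : ∀ i, Function.Injective (r i))
    (z : ι → X) (hz : Function.Injective z) (hz_min : ∀ i x, r i (z i) ≤ r i x)
    (hz_max : ∀ i j x, j ≠ i → x ∉ Set.range z → r i x < r i (z j))
    (hX : ∃ x, x ∉ Set.range z) (c : X → ι) (hc : ∀ i, c (z i) = i) :
    ∃ σ : Finset X, Dominant r σ ∧ σ.card = Fintype.card ι ∧ σ.image c = Finset.univ := by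
  classical
  obtain ⟨i₀⟩ := ‹Nonempty ι›
  -- Double counting of pairs (full set, deletable element). Every facet in `D` has two extensions,
  -- except the all-slack facet `z₀`, which has one. The total is odd, so some full set has an odd
  -- number of deletions and is rainbow.
  set R : Finset (Finset X) :=
    Finset.univ.filter fun σ => σ.card = Fintype.card ι ∧ Dominant r σ with hR
  set D : Finset (Finset X) := Finset.univ.filter fun τ =>
    Dominant r τ ∧ τ.card + 1 = Fintype.card ι ∧ τ.image c = Finset.univ.erase i₀ with hD
  set z₀ : Finset X := (Finset.univ.erase i₀).image z with hz₀
  have hcount : ∑ σ ∈ R, (σ.filter fun x => (σ.erase x).image c = Finset.univ.erase i₀).card =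
      ∑ τ ∈ D, (Finset.univ.filter fun x => x ∉ τ ∧ Dominant r (insert x τ)).card := by
    rw [← Finset.card_sigma, ← Finset.card_sigma]
    refine Finset.card_nbij' (fun p => ⟨p.1.erase p.2, p.2⟩) (fun p => ⟨insert p.2 p.1, p.2⟩)
      ?_ ?_ ?_ ?_
    · rintro ⟨σ, x⟩ h
      simp only [hR, hD, Finset.coe_sigma, Set.mem_sigma_iff, Finset.mem_coe, Finset.mem_filter,
        Finset.mem_univ, true_and] at h ⊢
      obtain ⟨⟨h1, h2⟩, h3, h4⟩ := h
      refine ⟨⟨h2.mono (Finset.erase_subset _ _), ?_, h4⟩, Finset.notMem_erase _ _, ?_⟩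
      · rw [Finset.card_erase_add_one h3, h1]
      · rwa [Finset.insert_erase h3]
    · rintro ⟨τ, x⟩ h
      simp only [hR, hD, Finset.coe_sigma, Set.mem_sigma_iff, Finset.mem_coe, Finset.mem_filter,
        Finset.mem_univ, true_and] at h ⊢
      obtain ⟨⟨h1, h2, h3⟩, h4, h5⟩ := h
      refine ⟨⟨?_, h5⟩, Finset.mem_insert_self _ _, ?_⟩
      · rw [Finset.card_insert_of_notMem h4, h2]
      · rwa [Finset.erase_insert h4]
    · rintro ⟨σ, x⟩ h
      simp only [Finset.coe_sigma, Set.mem_sigma_iff, Finset.mem_coe, Finset.mem_filter] at h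
      simp only [Finset.insert_erase h.2.1]
    · rintro ⟨τ, x⟩ h
      simp only [Finset.coe_sigma, Set.mem_sigma_iff, Finset.mem_coe, Finset.mem_filter] at h
      simp only [Finset.erase_insert h.2.2.1]
  -- the only facet with an odd number of extensions consists of slack elements
  have hdom₀ : ∀ x, x ∉ Set.range z →
      (Dominant r (insert x z₀) ↔ ∀ y, y ∉ Set.range z → r i₀ y ≤ r i₀ x) := by
    intro x hx
    constructor
    · intro h y hy
      obtain ⟨i, hi⟩ := h y
      have hii : i = i₀ := by
        by_contra hne
        have h1 := hi (z i) (Finset.mem_insert_of_mem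
          (Finset.mem_image_of_mem _ (Finset.mem_erase.2 ⟨hne, Finset.mem_univ _⟩)))
        exact hy ⟨i, hr i (le_antisymm (hz_min i y) h1)⟩
      subst hii
      exact hi x (Finset.mem_insert_self _ _)
    · intro h y
      by_cases hy : y ∈ Set.range z
      · obtain ⟨j, rfl⟩ := hy
        exact ⟨j, fun x _ => hz_min j x⟩
      · refine ⟨i₀, fun w hw => ?_⟩
        rcases Finset.mem_insert.1 hw with rfl | hw
        · exact h y hy
        · obtain ⟨j, hj, rfl⟩ := Finset.mem_image.1 hw
          exact (hz_max i₀ j y (Finset.mem_erase.1 hj).1 hy).le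
  obtain ⟨w, hw, hwmax⟩ : ∃ w, w ∉ Set.range z ∧ ∀ y, y ∉ Set.range z → r i₀ y ≤ r i₀ w := by
    obtain ⟨x, hx⟩ := hX
    obtain ⟨w, hw, h⟩ := Finset.exists_max_image
      (Finset.univ.filter fun x => x ∉ Set.range z) (r i₀) ⟨x, by simpa using hx⟩
    simp only [Finset.mem_filter, Finset.mem_univ, true_and] at hw h
    exact ⟨w, hw, h⟩
  have hz₀D : z₀ ∈ D := by
    simp only [hD, Finset.mem_filter, Finset.mem_univ, true_and]
    refine ⟨((hdom₀ w hw).2 hwmax).mono (Finset.subset_insert _ _), ?_, ?_⟩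
    · rw [hz₀, Finset.card_image_of_injective _ hz, Finset.card_erase_add_one (Finset.mem_univ _),
        Finset.card_univ]
    · rw [hz₀, Finset.image_image]
      have : c ∘ z = id := funext hc
      rw [this, Finset.image_id]
  have hone : (Finset.univ.filter fun x => x ∉ z₀ ∧ Dominant r (insert x z₀)).card = 1 := by
    rw [Finset.card_eq_one]
    refine ⟨w, ?_⟩
    ext x
    simp only [Finset.mem_filter, Finset.mem_univ, true_and, Finset.mem_singleton]
    constructor
    · rintro ⟨h1, h2⟩
      have hx : x ∉ Set.range z := by
        rintro ⟨j, rfl⟩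
        by_cases hj : j = i₀
        · subst hj
          obtain ⟨i, hi⟩ := h2 w
          have h3 : r i w ≤ r i (z i) := by
            apply hi
            by_cases hij : i = j
            · rw [hij]; exact Finset.mem_insert_self _ _
            · exact Finset.mem_insert_of_mem
                (Finset.mem_image_of_mem _ (Finset.mem_erase.2 ⟨hij, Finset.mem_univ _⟩))
          exact hw ⟨i, hr i (le_antisymm (hz_min i w) h3)⟩
        · exact h1 (Finset.mem_image_of_mem _ (Finset.mem_erase.2 ⟨hj, Finset.mem_univ _⟩))
      exact hr i₀ (le_antisymm (hwmax x hx) ((hdom₀ x hx).1 h2 w hw))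
    · rintro rfl
      refine ⟨fun h => ?_, (hdom₀ x hw).2 hwmax⟩
      obtain ⟨j, -, hj⟩ := Finset.mem_image.1 h
      exact hw ⟨j, hj⟩
  have htwo : ∀ τ ∈ D.erase z₀,
      (Finset.univ.filter fun x => x ∉ τ ∧ Dominant r (insert x τ)).card = 2 := by
    intro τ hτ
    obtain ⟨hτne, hτD⟩ := Finset.mem_erase.1 hτ
    simp only [hD, Finset.mem_filter, Finset.mem_univ, true_and] at hτD
    obtain ⟨hdom, hcard, himg⟩ := hτD
    obtain ⟨x, hxτ, hx⟩ : ∃ x ∈ τ, x ∉ Set.range z := by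
      by_contra hcon
      push Not at hcon
      apply hτne
      apply Finset.eq_of_subset_of_card_le
      · intro x hx
        obtain ⟨j, rfl⟩ := hcon x hx
        refine Finset.mem_image_of_mem _ ?_
        rw [← himg]
        exact Finset.mem_image.2 ⟨z j, hx, hc j⟩
      · rw [hz₀, Finset.card_image_of_injective _ hz, Finset.card_erase_of_mem (Finset.mem_univ _),
          Finset.card_univ]
        omega
    -- The slack `z a` beats the non-slack `x` in every ranking other than `a`.
    exact card_extensions_eq_two hr hcard ⟨x, hxτ⟩ hdom fun a =>
      ⟨z a, fun i hi => ⟨x, hxτ, hz_max i a x hi.symm hx⟩⟩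
  have hodd : Odd (∑ τ ∈ D, (Finset.univ.filter fun x => x ∉ τ ∧ Dominant r (insert x τ)).card) := by
    rw [← Finset.add_sum_erase _ _ hz₀D, hone, Finset.sum_congr rfl htwo, Finset.sum_const]
    exact ⟨(D.erase z₀).card, by simp; ring⟩
  rw [← hcount] at hodd
  obtain ⟨σ, hσ, hσodd⟩ : ∃ σ ∈ R,
      Odd (σ.filter fun x => (σ.erase x).image c = Finset.univ.erase i₀).card := by
    by_contra hcon
    push Not at hcon
    exact absurd (Finset.even_sum _ fun σ hσ => by simpa using hcon σ hσ) (by simpa using hodd)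
  simp only [hR, Finset.mem_filter, Finset.mem_univ, true_and] at hσ
  exact ⟨σ, hσ.2, hσ.1, (odd_card_deletions_iff c i₀ hσ.1).1 hσodd⟩

end Scarf

/-- A discrete Knaster–Kuratowski–Mazurkiewicz lemma: for every colouring of the grid points of a
simplex there is a grid point at which every colour either appears nearby or belongs to a small
coordinate. -/
theorem exists_gridPoint_near_colours {n : ℕ} (hn : 1 ≤ n) (N : ℕ) (c : (Fin n → ℕ) → Fin n) :
    ∃ x : Fin n → ℕ, ∑ i, x i = N ∧ ∀ j, x j ≤ n ∨
      ∃ x' : Fin n → ℕ, ∑ i, x' i = N ∧ c x' = j ∧ ∀ i, x i ≤ x' i + n ∧ x' i ≤ x i + n := by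
  classical
  have : Nonempty (Fin n) := ⟨⟨0, hn⟩⟩
  let T := {x : Fin n → Fin (N + 1) // ∑ i, (x i : ℕ) = N}
  let M := Fintype.card T
  let e : T ≃ Fin M := Fintype.equivFin T
  -- Ranking `i` compares `i`-th coordinates, with ties broken by the enumeration `e`. The slack `i`
  -- is at the bottom, the other slacks are above all grid points.
  let r : Fin n → T ⊕ Fin n → ℕ := fun i => Sum.elim (fun t => (t.1 i : ℕ) * M + e t + 1)
    (fun j => if j = i then 0 else (N + 1) * M + 1 + j)
  have hlt : ∀ i (t : T), (t.1 i : ℕ) * M + e t + 1 < (N + 1) * M + 1 := fun i t => by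
    have h1 : (t.1 i : ℕ) ≤ N := Nat.lt_succ_iff.1 (t.1 i).2
    have h2 := (e t).2
    nlinarith [Nat.mul_le_mul_right M h1]
  have hmono : ∀ i (s t : T), r i (Sum.inl s) ≤ r i (Sum.inl t) → (s.1 i : ℕ) ≤ t.1 i := by
    intro i s t h
    simp only [r, Sum.elim_inl] at h
    by_contra hcon
    push Not at hcon
    have h2 := (e t).2
    nlinarith [Nat.mul_le_mul_right M (Nat.succ_le_of_lt hcon)]
  have hr : ∀ i, Function.Injective (r i) := by
    intro i x y h
    rcases x with s | j <;> rcases y with t | l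
    · have h1 := hmono i s t h.le
      have h2 := hmono i t s h.ge
      have h3 : (s.1 i : ℕ) = t.1 i := le_antisymm h1 h2
      simp only [r, Sum.elim_inl, h3] at h
      have : e s = e t := Fin.ext (by omega)
      rw [e.injective this]
    · have := hlt i s
      simp only [r, Sum.elim_inl, Sum.elim_inr] at h
      (split_ifs at h; omega)
    · have := hlt i t
      simp only [r, Sum.elim_inl, Sum.elim_inr] at h
      (split_ifs at h; omega)
    · simp only [r, Sum.elim_inr] at h
      split_ifs at h with h1 h2 h2
      · rw [h1, h2]
      · omega
      · omega
      · rw [Fin.ext (show (j : ℕ) = l by omega)]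
  have hrange : ∀ x : T ⊕ Fin n, x ∉ Set.range (Sum.inr : Fin n → T ⊕ Fin n) → ∃ t, x = Sum.inl t := by
    rintro (t | j) h
    · exact ⟨t, rfl⟩
    · exact absurd ⟨j, rfl⟩ h
  -- grid points above a prescribed lower bound
  have hgrid : ∀ (C : Finset (Fin n)) (l : Fin n → ℕ), C.Nonempty → ∑ i ∈ C, l i ≤ N →
      ∃ t : T, ∀ i ∈ C, l i ≤ t.1 i := by
    rintro C l ⟨i₀, hi₀⟩ hl
    let y : Fin n → ℕ := fun i =>
      (if i ∈ C then l i else 0) + (if i = i₀ then N - ∑ i ∈ C, l i else 0)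
    have hy : ∑ i, y i = N := by
      simp only [y, Finset.sum_add_distrib, Finset.sum_ite_mem, Finset.univ_inter,
        Finset.sum_ite_eq', Finset.mem_univ, if_true]
      omega
    have hyN : ∀ i, y i ≤ N := fun i => by
      rw [← hy]; exact Finset.single_le_sum (fun _ _ => Nat.zero_le _) (Finset.mem_univ i)
    refine ⟨⟨fun i => ⟨y i, Nat.lt_succ_of_le (hyN i)⟩, hy⟩, fun i hi => ?_⟩
    simp [y, hi]
  obtain ⟨σ, hdom, hcard, himg⟩ := exists_rainbow_dominant hr (Sum.inr : Fin n → T ⊕ Fin n)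
    Sum.inr_injective (fun i x => by simp [r])
    (fun i j x hj hx => by
      obtain ⟨t, rfl⟩ := hrange x hx
      have := hlt i t
      simp only [r, Sum.elim_inl, Sum.elim_inr, if_neg hj]
      omega)
    (by
      obtain ⟨t, -⟩ := hgrid {⟨0, hn⟩} (fun _ => 0) (Finset.singleton_nonempty _) (by simp)
      exact ⟨Sum.inl t, by simp⟩)
    (Sum.elim (fun t => c fun i => t.1 i) id) (fun i => rfl)
  set C : Finset (Fin n) := Finset.univ.filter fun i => (Sum.inr i : T ⊕ Fin n) ∉ σ with hC
  set τ : Finset T := Finset.univ.filter fun t => (Sum.inl t : T ⊕ Fin n) ∈ σ with hτ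
  have hcol : ∀ j ∈ C, ∃ t ∈ τ, (c fun i => t.1 i) = j := by
    intro j hj
    have : j ∈ σ.image (Sum.elim (fun t : T => c fun i => t.1 i) id) := by
      rw [himg]; exact Finset.mem_univ _
    obtain ⟨x, hx, hxj⟩ := Finset.mem_image.1 this
    rcases x with t | l
    · exact ⟨t, by simpa [hτ] using hx, hxj⟩
    · simp only [Sum.elim_inr, id] at hxj
      subst hxj
      simp only [hC, Finset.mem_filter, Finset.mem_univ, true_and] at hj
      exact absurd hx hj
  -- dominance of grid points only involves the coordinates in `C`
  have hdomT : ∀ y : T, ∃ i ∈ C, ∀ t ∈ τ, (y.1 i : ℕ) ≤ t.1 i := by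
    intro y
    obtain ⟨i, hi⟩ := hdom (Sum.inl y)
    refine ⟨i, ?_, fun t ht => hmono i y t (hi _ (by simpa [hτ] using ht))⟩
    simp only [hC, Finset.mem_filter, Finset.mem_univ, true_and]
    intro hmem
    have := hi _ hmem
    simp [r] at this
  have hCne : C.Nonempty := by
    obtain ⟨t, -⟩ := hgrid {⟨0, hn⟩} (fun _ => 0) (Finset.singleton_nonempty _) (by simp)
    obtain ⟨i, hi, -⟩ := hdomT t
    exact ⟨i, hi⟩
  have hτne : τ.Nonempty := by
    obtain ⟨j, hj⟩ := hCne
    obtain ⟨t, ht, -⟩ := hcol j hj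
    exact ⟨t, ht⟩
  have hmin : ∀ i : Fin n, ∃ t ∈ τ, ∀ s ∈ τ, (t.1 i : ℕ) ≤ s.1 i := fun i =>
    τ.exists_min_image (fun t => (t.1 i : ℕ)) hτne
  choose m hm hmle using hmin
  -- Otherwise some grid point would exceed all minima on `C`, against dominance. So for a point of
  -- `τ`, the excess over the minima on `C` plus the mass off `C` is less than `C.card ≤ n`; all the
  -- closeness bounds follow.
  have hbig : N < ∑ i ∈ C, ((m i).1 i + 1 : ℕ) := by
    by_contra hcon
    obtain ⟨y, hy⟩ := hgrid C _ hCne (not_lt.1 hcon)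
    obtain ⟨i, hi, h⟩ := hdomT y
    have h1 := hy i hi
    have h2 := h _ (hm i)
    omega
  have hCn : C.card ≤ n := by simpa using Finset.card_le_univ C
  rw [Finset.sum_add_distrib, Finset.sum_const, smul_eq_mul, mul_one] at hbig
  have hsplit : ∀ t : T, ∑ i ∈ C, (t.1 i : ℕ) + ∑ i ∈ Cᶜ, (t.1 i : ℕ) = N := fun t => by
    rw [Finset.sum_add_sum_compl]; exact t.2
  have hnear : ∀ t ∈ τ, ∀ i ∈ C, (t.1 i : ℕ) ≤ (m i).1 i + n := by
    intro t ht i hi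
    have h1 := hsplit t
    rw [← Finset.add_sum_erase _ _ hi] at h1 hbig
    have h2 : ∑ j ∈ C.erase i, ((m j).1 j : ℕ) ≤ ∑ j ∈ C.erase i, (t.1 j : ℕ) :=
      Finset.sum_le_sum fun j _ => hmle j t ht
    omega
  have hsmall : ∀ t ∈ τ, ∀ i, i ∉ C → (t.1 i : ℕ) ≤ n := by
    intro t ht i hi
    have h1 := hsplit t
    have h2 : ∑ j ∈ C, ((m j).1 j : ℕ) ≤ ∑ j ∈ C, (t.1 j : ℕ) :=
      Finset.sum_le_sum fun j _ => hmle j t ht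
    have h3 : (t.1 i : ℕ) ≤ ∑ j ∈ Cᶜ, (t.1 j : ℕ) :=
      Finset.single_le_sum (f := fun j => (t.1 j : ℕ)) (fun _ _ => Nat.zero_le _)
        (Finset.mem_compl.2 hi)
    omega
  obtain ⟨x, hx⟩ := hτne
  refine ⟨fun i => x.1 i, x.2, fun j => ?_⟩
  by_cases hj : j ∈ C
  · right
    obtain ⟨t, ht, htj⟩ := hcol j hj
    refine ⟨fun i => t.1 i, t.2, htj, fun i => ?_⟩
    by_cases hi : i ∈ C
    · have h1 := hnear x hx i hi
      have h2 := hnear t ht i hi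
      have h3 := hmle i x hx
      have h4 := hmle i t ht
      dsimp only
      omega
    · have h1 := hsmall x hx i hi
      have h2 := hsmall t ht i hi
      dsimp only
      omega
  · left
    exact hsmall x hx j hj

/-! ### From the discrete lemma to envy-free divisions -/

open Filter Topology

/-- A Knaster–Kuratowski–Mazurkiewicz lemma, in the form where each set contains the facet opposite
to its vertex. -/
theorem exists_mem_forall_of_facet_cover {n : ℕ} (hn : 1 ≤ n) (B : Fin n → Set (Fin n → ℝ))
    (hB : ∀ j, IsClosed (B j)) (hcover : ∀ x ∈ stdSimplex ℝ (Fin n), ∃ j, x ∈ B j)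
    (hfacet : ∀ x ∈ stdSimplex ℝ (Fin n), ∀ j, x j = 0 → x ∈ B j) :
    ∃ x ∈ stdSimplex ℝ (Fin n), ∀ j, x ∈ B j := by
  have step : ∀ m : ℕ, ∃ x ∈ stdSimplex ℝ (Fin n), ∀ j, x j ≤ n / (m + 1 : ℝ) ∨
      ∃ x' ∈ B j, dist x x' ≤ n / (m + 1 : ℝ) := by
    intro m
    have hm : (0 : ℝ) < m + 1 := by positivity
    have hmem : ∀ y : Fin n → ℕ, ∑ i, y i = m + 1 →
        (fun i => (y i : ℝ) / (m + 1)) ∈ stdSimplex ℝ (Fin n) := by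
      intro y hy
      refine ⟨fun i => by positivity, ?_⟩
      rw [← Finset.sum_div, ← Nat.cast_sum, hy]
      push_cast
      exact div_self hm.ne'
    have hcol : ∀ y : Fin n → ℕ, ∃ j, ∑ i, y i = m + 1 → (fun i => (y i : ℝ) / (m + 1)) ∈ B j := by
      intro y
      by_cases hy : ∑ i, y i = m + 1
      · obtain ⟨j, hj⟩ := hcover _ (hmem y hy)
        exact ⟨j, fun _ => hj⟩
      · exact ⟨⟨0, hn⟩, fun h => absurd h hy⟩
    choose c hc using hcol
    obtain ⟨x, hx, hxj⟩ := exists_gridPoint_near_colours hn (m + 1) c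
    refine ⟨_, hmem x hx, fun j => ?_⟩
    rcases hxj j with h | ⟨x', hx', hcx', hnear⟩
    · left
      have : (x j : ℝ) ≤ n := by exact_mod_cast h
      gcongr
    · right
      refine ⟨_, hcx' ▸ hc x' hx', ?_⟩
      rw [dist_pi_le_iff (by positivity)]
      intro i
      have h1 : (x i : ℝ) ≤ x' i + n := by exact_mod_cast (hnear i).1
      have h2 : (x' i : ℝ) ≤ x i + n := by exact_mod_cast (hnear i).2
      rw [Real.dist_eq, ← sub_div, abs_div, abs_of_pos hm]
      gcongr
      rw [abs_le]
      constructor <;> linarith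
  choose u hu hu' using step
  obtain ⟨x, hx, φ, hφ, hlim⟩ := (isCompact_stdSimplex ℝ (Fin n)).tendsto_subseq hu
  have hmesh : Tendsto (fun m => (n : ℝ) / ((φ m : ℝ) + 1)) atTop (𝓝 0) :=
    ((tendsto_const_div_atTop_nhds_zero_nat (n : ℝ)).comp (tendsto_add_atTop_nat 1)).comp
      hφ.tendsto_atTop |>.congr fun m => by simp
  refine ⟨x, hx, fun j => ?_⟩
  -- If coordinate `j` is small infinitely often, it vanishes in the limit and the facet hypothesis
  -- applies. If not, points of the closed set `B j` approach `x`.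
  by_cases hfreq : ∃ᶠ m in atTop, u (φ m) j ≤ n / ((φ m : ℝ) + 1)
  · apply hfacet x hx
    have h1 : Tendsto (fun m => u (φ m) j - n / ((φ m : ℝ) + 1)) atTop (𝓝 (x j - 0)) :=
      ((continuous_apply j).continuousAt.tendsto.comp hlim).sub hmesh
    have h2 : x j - 0 ≤ 0 := le_of_tendsto_of_frequently h1 (hfreq.mono fun m hm => by linarith)
    exact le_antisymm (by linarith) (hx.1 j)
  · rw [Filter.not_frequently] at hfreq
    rw [← (hB j).closure_eq, Metric.mem_closure_iff]
    intro ε hε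
    have h1 : ∀ᶠ m in atTop, dist (u (φ m)) x < ε / 2 := Metric.tendsto_nhds.1 hlim _ (half_pos hε)
    have h2 : ∀ᶠ m in atTop, (n : ℝ) / ((φ m : ℝ) + 1) < ε / 2 :=
      hmesh.eventually_lt_const (half_pos hε)
    obtain ⟨m, hm, h1, h2⟩ := (hfreq.and (h1.and h2)).exists
    rcases hu' (φ m) j with h | ⟨x', hx', hd⟩
    · exact absurd h hm
    · refine ⟨x', hx', ?_⟩
      calc dist x x' ≤ dist x (u (φ m)) + dist (u (φ m)) x' := dist_triangle _ _ _
        _ < ε := by rw [dist_comm x]; linarith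

/-- If all players strictly dislike empty pieces, there is a division in which every player gets a
piece that is best up to `ε`. -/
theorem exists_perm_almost_best {n : ℕ} (hn : 1 ≤ n) (v : Fin n → Fin n → (Fin n → ℝ) → ℝ)
    (hv : ∀ i j, Continuous (v i j)) {ε : ℝ} (hε : 0 < ε)
    (hungry : ∀ x ∈ stdSimplex ℝ (Fin n), ∀ i j, x j = 0 → ∃ l, v i j x + ε ≤ v i l x) :
    ∃ x ∈ stdSimplex ℝ (Fin n), ∃ σ : Equiv.Perm (Fin n), ∀ i j,
      v i j x ≤ v i (σ i) x + ε := by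
  have hne : (Finset.univ : Finset (Fin n)).Nonempty := ⟨⟨0, hn⟩, Finset.mem_univ _⟩
  let V : Fin n → (Fin n → ℝ) → ℝ := fun i x => Finset.univ.sup' hne fun j => v i j x
  have hVc : ∀ i, Continuous (V i) := fun i => Continuous.finset_sup'_apply hne fun j _ => hv i j
  have hVle : ∀ i j x, v i j x ≤ V i x := fun i j x =>
    Finset.le_sup' (fun j => v i j x) (Finset.mem_univ j)
  -- Continuous weights supported on the pieces that are best up to `ε`, normalised below to `w`.
  -- The covering lemma finds a point where no piece attracts total weight above `1`. The total
  -- being `n`, all column sums equal `1`, and a permutation in the Birkhoff decomposition uses only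
  -- positive weights.
  let p : Fin n → Fin n → (Fin n → ℝ) → ℝ := fun i j x => max 0 (v i j x - V i x + ε)
  have hpc : ∀ i j, Continuous (p i j) := fun i j =>
    continuous_const.max (((hv i j).sub (hVc i)).add continuous_const)
  have hp0 : ∀ i j x, 0 ≤ p i j x := fun i j x => le_max_left _ _
  let q : Fin n → (Fin n → ℝ) → ℝ := fun i x => ∑ j, p i j x
  have hq : ∀ i x, 0 < q i x := fun i x => by
    obtain ⟨j, -, hj⟩ := Finset.exists_mem_eq_sup' hne fun j => v i j x
    refine Finset.sum_pos' (fun j _ => hp0 i j x) ⟨j, Finset.mem_univ _, ?_⟩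
    refine lt_max_of_lt_right ?_
    have : V i x = v i j x := hj
    rw [this]; linarith
  let w : Fin n → Fin n → (Fin n → ℝ) → ℝ := fun i j x => p i j x / q i x
  have hwc : ∀ i j, Continuous (w i j) := fun i j =>
    (hpc i j).div (continuous_finsetSum _ fun j _ => hpc i j) fun x => (hq i x).ne'
  have hw0 : ∀ i j x, 0 ≤ w i j x := fun i j x => div_nonneg (hp0 i j x) (hq i x).le
  have hw1 : ∀ i x, ∑ j, w i j x = 1 := fun i x => by
    simp only [w]
    rw [← Finset.sum_div]
    exact div_self (hq i x).ne'
  have htot : ∀ x, ∑ j, ∑ i, w i j x = ∑ _j : Fin n, (1 : ℝ) := fun x => by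
    rw [Finset.sum_comm]
    exact Finset.sum_congr rfl fun i _ => hw1 i x
  obtain ⟨x, hx, hxB⟩ := exists_mem_forall_of_facet_cover hn (fun j => {x | ∑ i, w i j x ≤ 1})
    (fun j => isClosed_le (continuous_finsetSum _ fun i _ => hwc i j) continuous_const)
    (fun x _ => by
      obtain ⟨j, -, hj⟩ := Finset.exists_le_of_sum_le hne (htot x).le
      exact ⟨j, hj⟩)
    (fun x hx j hj => by
      have : ∑ i, w i j x = 0 := Finset.sum_eq_zero fun i _ => by
        obtain ⟨l, hl⟩ := hungry x hx i j hj
        have h1 : p i j x = 0 := max_eq_left (by linarith [hVle i l x])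
        simp only [w, h1, zero_div]
      simp only [Set.mem_ofPred_eq, this]
      exact zero_le_one)
  have hcolumn : ∀ j, ∑ i, w i j x = 1 := by
    have := (Finset.sum_eq_sum_iff_of_le fun j _ => hxB j).1 (htot x)
    exact fun j => this j (Finset.mem_univ j)
  have hds : (Matrix.of fun i j => w i j x) ∈ doublyStochastic ℝ (Fin n) :=
    mem_doublyStochastic_iff_sum.2 ⟨fun i j => hw0 i j x, fun i => hw1 i x, fun j => hcolumn j⟩
  obtain ⟨α, hα0, hα1, hα⟩ := exists_eq_sum_perm_of_mem_doublyStochastic hds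
  obtain ⟨σ, -, hσ⟩ : ∃ σ ∈ (Finset.univ : Finset (Equiv.Perm (Fin n))), 0 < α σ := by
    apply Finset.exists_lt_of_sum_lt
    rw [hα1]; simp
  refine ⟨x, hx, σ, fun i j => ?_⟩
  have hpos : 0 < w i (σ i) x := by
    have h1 : w i (σ i) x = ∑ ρ : Equiv.Perm (Fin n), α ρ * (ρ.permMatrix ℝ) i (σ i) := by
      have := congrFun (congrFun hα i) (σ i)
      rw [Matrix.sum_apply] at this
      simpa using this.symm
    rw [h1]
    refine Finset.sum_pos' (fun ρ _ => mul_nonneg (hα0 ρ) ?_) ⟨σ, Finset.mem_univ _, ?_⟩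
    · rw [Equiv.Perm.permMatrix, PEquiv.toMatrix_apply]
      split_ifs <;> norm_num
    · rw [Equiv.Perm.permMatrix, PEquiv.toMatrix_apply]
      simpa using hσ
  have hppos : 0 < p i (σ i) x := by
    by_contra h
    have : p i (σ i) x = 0 := le_antisymm (not_lt.1 h) (hp0 _ _ _)
    simp only [w, this, zero_div, lt_irrefl] at hpos
  have h2 : 0 < v i (σ i) x - V i x + ε := by
    rcases lt_max_iff.1 hppos with h | h
    · exact absurd h (lt_irrefl _)
    · exact h
  linarith [hVle i j x]

/-- Existence of envy-free divisions for players who strictly dislike empty pieces. -/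
theorem exists_perm_best {n : ℕ} (hn : 1 ≤ n) (v : Fin n → Fin n → (Fin n → ℝ) → ℝ)
    (hv : ∀ i j, Continuous (v i j)) {δ : ℝ} (hδ : 0 < δ)
    (hungry : ∀ x ∈ stdSimplex ℝ (Fin n), ∀ i j, x j = 0 → ∃ l, v i j x + δ ≤ v i l x) :
    ∃ x ∈ stdSimplex ℝ (Fin n), ∃ σ : Equiv.Perm (Fin n), ∀ i j, v i j x ≤ v i (σ i) x := by
  have step : ∀ m : ℕ, ∃ x ∈ stdSimplex ℝ (Fin n), ∃ σ : Equiv.Perm (Fin n), ∀ i j,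
      v i j x ≤ v i (σ i) x + δ / (m + 1 : ℝ) := fun m => by
    refine exists_perm_almost_best hn v hv (by positivity) fun x hx i j hj => ?_
    obtain ⟨l, hl⟩ := hungry x hx i j hj
    have : δ / (m + 1 : ℝ) ≤ δ := div_le_self hδ.le (by linarith [Nat.cast_nonneg (α := ℝ) m])
    exact ⟨l, by linarith⟩
  choose u hu ρ hρ using step
  obtain ⟨x, hx, φ, hφ, hlim⟩ := (isCompact_stdSimplex ℝ (Fin n)).tendsto_subseq hu
  have hmesh : Tendsto (fun m => δ / ((φ m : ℝ) + 1)) atTop (𝓝 0) :=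
    ((tendsto_const_div_atTop_nhds_zero_nat δ).comp (tendsto_add_atTop_nat 1)).comp
      hφ.tendsto_atTop |>.congr fun m => by simp
  -- There are finitely many permutations, so one recurs along the convergent subsequence.
  obtain ⟨σ, hσ⟩ : ∃ σ, ∃ᶠ m in atTop, ρ (φ m) = σ := by
    by_contra hcon
    push Not at hcon
    have := Filter.eventually_all.2 hcon
    obtain ⟨m, hm⟩ := this.exists
    exact hm _ rfl
  refine ⟨x, hx, σ, fun i j => ?_⟩
  have h1 : Tendsto (fun m => v i j (u (φ m)) - v i (σ i) (u (φ m)) - δ / ((φ m : ℝ) + 1)) atTop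
      (𝓝 (v i j x - v i (σ i) x - 0)) :=
    ((((hv i j).tendsto x).comp hlim).sub (((hv i (σ i)).tendsto x).comp hlim)).sub hmesh
  have h2 := le_of_tendsto_of_frequently (b := 0) h1 (hσ.mono fun m hm => by
    have := hρ (φ m) i j
    rw [hm] at this
    linarith)
  linarith

/-- Existence of envy-free divisions into consecutive intervals, in terms of the cumulative
value functions of the players. -/
theorem exists_envyFree_cuts {n : ℕ} (hn : 1 ≤ n) (F : Fin n → ℝ → ℝ) (hF : ∀ i, Continuous (F i))
    (hF0 : ∀ i, F i 0 = 0) (hF1 : ∀ i, F i 1 = 1) :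
    ∃ s : ℕ → ℝ, Monotone s ∧ s 0 = 0 ∧ s n = 1 ∧ ∃ σ : Equiv.Perm (Fin n), ∀ i j : Fin n,
      F i (s (j + 1)) - F i (s j) ≤ F i (s (σ i + 1)) - F i (s (σ i)) := by
  -- A point of the simplex lists the lengths of consecutive intervals; the partial sums `S` are the
  -- cut positions.
  let S : (Fin n → ℝ) → ℕ → ℝ := fun x m => ∑ l : Fin n, if (l : ℕ) < m then x l else 0
  have hSc : ∀ m, Continuous fun x => S x m := fun m =>
    continuous_finsetSum _ fun l _ => by
      split_ifs
      · exact continuous_apply l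
      · exact continuous_const
  have hS0 : ∀ x, S x 0 = 0 := fun x => by simp [S]
  have hS1 : ∀ x ∈ stdSimplex ℝ (Fin n), S x n = 1 := fun x hx => by simpa [S] using hx.2
  have hSs : ∀ x (j : Fin n), S x (j + 1) = S x j + x j := fun x j => by
    have : x j = ∑ l : Fin n, if l = j then x l else 0 := by simp
    simp only [S]
    conv_rhs => rw [this]
    rw [← Finset.sum_add_distrib]
    refine Finset.sum_congr rfl fun l _ => ?_
    rcases lt_trichotomy (l : ℕ) j with h | h | h
    · rw [if_pos (by omega), if_pos h, if_neg (fun e => by rw [e] at h; omega), add_zero]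
    · rw [if_pos (by omega), if_neg (by omega), if_pos (Fin.ext h), zero_add]
    · rw [if_neg (by omega), if_neg (by omega), if_neg (fun e => by rw [e] at h; omega), add_zero]
  have hnpos : (0 : ℝ) < n := by exact_mod_cast hn
  obtain ⟨x, hx, σ, hσ⟩ := exists_perm_best hn
    (fun i j x => F i (S x (j + 1)) - F i (S x j))
    (fun i j => ((hF i).comp (hSc _)).sub ((hF i).comp (hSc _)))
    -- An empty piece is worth `0`, while some piece is worth at least the average `1/n`.
    (δ := 1 / n) (by positivity) (fun x hx i j hj => by
      have hsum : ∑ l : Fin n, (F i (S x (l + 1)) - F i (S x l)) = 1 := by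
        rw [Fin.sum_univ_eq_sum_range (fun l => F i (S x (l + 1)) - F i (S x l)) n,
          Finset.sum_range_sub (fun l => F i (S x l)), hS0, hS1 x hx, hF0, hF1, sub_zero]
      obtain ⟨l, -, hl⟩ := Finset.exists_le_of_sum_le (s := (Finset.univ : Finset (Fin n)))
        (f := fun _ => (1 : ℝ) / n) (g := fun l : Fin n => F i (S x (l + 1)) - F i (S x l))
        ⟨⟨0, hn⟩, Finset.mem_univ _⟩ (by
          rw [hsum, Finset.sum_const, Finset.card_univ, Fintype.card_fin, nsmul_eq_mul]
          exact (mul_one_div_cancel hnpos.ne').le)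
      refine ⟨l, ?_⟩
      rw [hSs x j, hj, add_zero, sub_self, zero_add]
      exact hl)
  refine ⟨S x, fun a b hab => ?_, hS0 x, hS1 x hx, σ, hσ⟩
  refine Finset.sum_le_sum fun l _ => ?_
  have := hx.1 l
  split_ifs
  · exact le_rfl
  · omega
  · exact this
  · exact le_rfl

/-! ### Cumulative values -/

theorem Instance.integrableOn_density {n : ℕ} (I : Instance n) (i : Fin n) :
    IntegrableOn (I.density i) (Set.Icc 0 1) :=
  (I.continuousOn i).integrableOn_Icc

/-- The value to player `i` of the part of the cake to the left of `t`. -/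
def Instance.cdf {n : ℕ} (I : Instance n) (i : Fin n) (t : ℝ) : ℝ :=
  ∫ x in (0 : ℝ)..t, (Set.Icc (0 : ℝ) 1).indicator (I.density i) x

theorem Instance.integrable_indicator {n : ℕ} (I : Instance n) (i : Fin n) :
    Integrable ((Set.Icc (0 : ℝ) 1).indicator (I.density i)) :=
  (integrable_indicator_iff measurableSet_Icc).2 (I.integrableOn_density i)

/-- Cutting off the density outside the cake makes the primitive continuous on the whole line, as
`exists_envyFree_cuts` demands. -/
theorem Instance.continuous_cdf {n : ℕ} (I : Instance n) (i : Fin n) : Continuous (I.cdf i) :=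
  (I.integrable_indicator i).continuous_primitive 0

theorem Instance.cdf_zero {n : ℕ} (I : Instance n) (i : Fin n) : I.cdf i 0 = 0 :=
  intervalIntegral.integral_same

/-- The value of an interval, with or without its endpoints. -/
theorem Instance.value_interval {n : ℕ} (I : Instance n) (i : Fin n) {S : Set ℝ} {a b : ℝ}
    (ha : 0 ≤ a) (hab : a ≤ b) (hb : b ≤ 1) (h1 : Set.Ioo a b ⊆ S) (h2 : S ⊆ Set.Icc a b) :
    I.value i S = I.cdf i b - I.cdf i a := by
  have hS : S =ᵐ[volume] Set.Ioc a b := by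
    refine EventuallyLE.antisymm ?_ ?_
    · exact (LE.le.eventuallyLE h2).trans Ioc_ae_eq_Icc.symm.le
    · exact Ioo_ae_eq_Ioc.symm.le.trans (LE.le.eventuallyLE h1)
  rw [Instance.value, setIntegral_congr_set hS, Instance.cdf, Instance.cdf,
    intervalIntegral.integral_interval_sub_left (I.integrable_indicator i).intervalIntegrable
      (I.integrable_indicator i).intervalIntegrable,
    intervalIntegral.integral_of_le hab]
  refine setIntegral_congr_fun measurableSet_Ioc fun x hx => ?_
  rw [Set.indicator_of_mem]
  exact ⟨ha.trans hx.1.le, hx.2.trans hb⟩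

theorem Instance.cdf_one {n : ℕ} (I : Instance n) (i : Fin n) : I.cdf i 1 = 1 := by
  have h := I.value_interval i (S := Set.Icc 0 1) le_rfl zero_le_one le_rfl
    Set.Ioo_subset_Icc_self subset_rfl
  rw [I.cdf_zero, sub_zero] at h
  rw [← h]
  exact I.normalized i

theorem Instance.value_mono {n : ℕ} (I : Instance n) (i : Fin n) {S T : Set ℝ}
    (hST : S ⊆ T) (hT : T ⊆ Set.Icc 0 1) (hTm : MeasurableSet T) : I.value i S ≤ I.value i T := by
  refine setIntegral_mono_set ((I.integrableOn_density i).mono_set hT) ?_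
    (LE.le.eventuallyLE hST)
  filter_upwards [ae_restrict_mem hTm] with x hx
  exact I.nonneg i x (hT hx)

theorem IsPortion.measurableSet {k : ℕ} {S : Set ℝ} (h : IsPortion k S) : MeasurableSet S := by
  obtain ⟨J, hJ, -, rfl⟩ := h
  exact MeasurableSet.iUnion fun m => (hJ m).1.measurableSet

theorem IsPortion.subset {k : ℕ} {S : Set ℝ} (h : IsPortion k S) : S ⊆ Set.Icc 0 1 := by
  obtain ⟨J, hJ, -, rfl⟩ := h
  exact Set.iUnion_subset fun m => (hJ m).2

theorem Instance.value_le_one {n : ℕ} (I : Instance n) (i : Fin n) {k : ℕ} {S : Set ℝ}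
    (h : IsPortion k S) : I.value i S ≤ 1 :=
  (I.value_mono i h.subset subset_rfl measurableSet_Icc).trans_eq (I.normalized i)

/-! ### Allocations in terms of the endpoints of the pieces -/

/-- The possible left and right endpoints of the pieces of an allocation. -/
def endpoints (freeDisposal : Bool) (n k : ℕ) :
    Set ((Fin n × Fin k → ℝ) × (Fin n × Fin k → ℝ)) :=
  {p | (∀ q, 0 ≤ p.1 q ∧ p.1 q ≤ p.2 q ∧ p.2 q ≤ 1) ∧
    (∀ q q', q ≠ q' → min (p.2 q) (p.2 q') ≤ max (p.1 q) (p.1 q')) ∧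
    (freeDisposal = false → ∑ q, (p.2 q - p.1 q) = 1)}

/-- The value to player `i` of the pieces of player `j`. -/
def Instance.worth {n k : ℕ} (I : Instance n) (i : Fin n)
    (p : (Fin n × Fin k → ℝ) × (Fin n × Fin k → ℝ)) (j : Fin n) : ℝ :=
  ∑ m, (I.cdf i (p.2 (j, m)) - I.cdf i (p.1 (j, m)))

/-- Disjointness is relaxed to non-overlapping interiors and covering to total length one, so that
all conditions are closed; degenerate pieces stand for empty ones. -/
theorem isCompact_endpoints (freeDisposal : Bool) (n k : ℕ) :
    IsCompact (endpoints freeDisposal n k) := by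
  have h1 : ∀ q, Continuous fun p : (Fin n × Fin k → ℝ) × (Fin n × Fin k → ℝ) => p.1 q :=
    fun q => (continuous_apply q).comp continuous_fst
  have h2 : ∀ q, Continuous fun p : (Fin n × Fin k → ℝ) × (Fin n × Fin k → ℝ) => p.2 q :=
    fun q => (continuous_apply q).comp continuous_snd
  refine (isCompact_Icc (a := (0 : (Fin n × Fin k → ℝ) × (Fin n × Fin k → ℝ)))
    (b := 1)).of_isClosed_subset ?_ ?_
  · simp only [endpoints, Set.ofPred_and, Set.ofPred_forall]
    refine ((isClosed_iInter fun q => ?_).inter ((isClosed_iInter fun q => isClosed_iInter fun q' =>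
      isClosed_iInter fun _ => ?_).inter (isClosed_iInter fun _ => ?_)))
    · exact (isClosed_le continuous_const (h1 q)).inter
        ((isClosed_le (h1 q) (h2 q)).inter (isClosed_le (h2 q) continuous_const))
    · exact isClosed_le ((h2 q).min (h2 q')) ((h1 q).max (h1 q'))
    · exact isClosed_eq (continuous_finsetSum _ fun q _ => (h2 q).sub (h1 q)) continuous_const
  · rintro p ⟨hp, -⟩
    exact ⟨⟨fun q => (hp q).1, fun q => (hp q).1.trans (hp q).2.1⟩,
      ⟨fun q => (hp q).2.1.trans (hp q).2.2, fun q => (hp q).2.2⟩⟩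

theorem Instance.continuous_worth {n k : ℕ} (I : Instance n) (i j : Fin n) :
    Continuous fun p : (Fin n × Fin k → ℝ) × (Fin n × Fin k → ℝ) => I.worth i p j :=
  continuous_finsetSum _ fun m _ =>
    ((I.continuous_cdf i).comp ((continuous_apply (j, m)).comp continuous_snd)).sub
      ((I.continuous_cdf i).comp ((continuous_apply (j, m)).comp continuous_fst))

theorem exists_endpoints_of_ordConnected {J : Set ℝ} (hJ : J.OrdConnected)
    (hJ' : J ⊆ Set.Icc 0 1) :
    ∃ a b : ℝ, (0 ≤ a ∧ a ≤ b ∧ b ≤ 1) ∧ Set.Ioo a b ⊆ J ∧ J ⊆ Set.Icc a b := by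
  rcases J.eq_empty_or_nonempty with rfl | hne
  · exact ⟨0, 0, ⟨le_rfl, le_rfl, zero_le_one⟩, by simp, by simp⟩
  have hbelow : BddBelow J := ⟨0, fun x hx => (hJ' hx).1⟩
  have habove : BddAbove J := ⟨1, fun x hx => (hJ' hx).2⟩
  refine ⟨sInf J, sSup J, ⟨le_csInf hne fun x hx => (hJ' hx).1, csInf_le_csSup hne hbelow habove,
    csSup_le hne fun x hx => (hJ' hx).2⟩, ?_, subset_Icc_csInf_csSup hbelow habove⟩
  exact IsConnected.Ioo_csInf_csSup_subset ⟨hne, hJ.isPreconnected⟩ hbelow habove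

theorem min_le_max_of_disjoint {a b a' b' : ℝ} {J J' : Set ℝ} (hJ : Set.Ioo a b ⊆ J)
    (hJ' : Set.Ioo a' b' ⊆ J') (h : Disjoint J J') : min b b' ≤ max a a' := by
  by_contra hcon
  push Not at hcon
  obtain ⟨x, h1, h2⟩ := exists_between hcon
  obtain ⟨h3, h4⟩ := max_lt_iff.1 h1
  obtain ⟨h5, h6⟩ := lt_min_iff.1 h2
  exact Set.disjoint_left.1 h (hJ ⟨h3, h5⟩) (hJ' ⟨h4, h6⟩)

theorem volume_interval {a b : ℝ} {J : Set ℝ} (h1 : Set.Ioo a b ⊆ J) (h2 : J ⊆ Set.Icc a b) :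
    volume J = ENNReal.ofReal (b - a) :=
  le_antisymm ((measure_mono h2).trans_eq Real.volume_Icc)
    (Real.volume_Ioo.symm.le.trans (measure_mono h1))

theorem volume_iUnion_intervals {κ : Type*} [Fintype κ] {a b : κ → ℝ} {J : κ → Set ℝ}
    (hab : ∀ q, a q ≤ b q) (hJm : ∀ q, (J q).OrdConnected)
    (h1 : ∀ q, Set.Ioo (a q) (b q) ⊆ J q) (h2 : ∀ q, J q ⊆ Set.Icc (a q) (b q))
    (hd : Pairwise (Function.onFun Disjoint J)) :
    volume (⋃ q, J q) = ENNReal.ofReal (∑ q, (b q - a q)) := by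
  rw [measure_iUnion hd fun q => (hJm q).measurableSet, tsum_fintype,
    ENNReal.ofReal_sum_of_nonneg fun q _ => sub_nonneg.2 (hab q)]
  exact Finset.sum_congr rfl fun q _ => volume_interval (h1 q) (h2 q)

theorem Instance.value_iUnion {n k : ℕ} (I : Instance n) (i : Fin n) {J : Fin k → Set ℝ}
    (hJ : ∀ m, (J m).OrdConnected ∧ J m ⊆ Set.Icc 0 1)
    (hd : ∀ m m', m ≠ m' → Disjoint (J m) (J m')) :
    I.value i (⋃ m, J m) = ∑ m, I.value i (J m) :=
  integral_iUnion_fintype (fun m => (hJ m).1.measurableSet) (fun m m' h => hd m m' h)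
    fun m => (I.integrableOn_density i).mono_set (hJ m).2

/-- Endpoints forget who owns a boundary point, which no value detects. Comparing Lebesgue measures
turns covering the cake into total length one. -/
theorem IsAllocation.exists_endpoints {freeDisposal : Bool} {n k : ℕ} {A : Fin n → Set ℝ}
    (hA : IsAllocation freeDisposal k A) :
    ∃ p ∈ endpoints freeDisposal n k, ∀ (I : Instance n) (i j : Fin n),
      I.value i (A j) = I.worth i p j := by
  choose J hJ hd hU using hA.portion
  choose a b hab h1 h2 using fun q : Fin n × Fin k =>
    exists_endpoints_of_ordConnected (hJ q.1 q.2).1 (hJ q.1 q.2).2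
  have hdisj : ∀ q q' : Fin n × Fin k, q ≠ q' → Disjoint (J q.1 q.2) (J q'.1 q'.2) := by
    rintro ⟨i, m⟩ ⟨i', m'⟩ hq
    by_cases hi : i = i'
    · subst hi
      exact hd i m m' fun h => hq (by rw [h])
    · have := hA.disjoint i i' hi
      rw [hU i, hU i'] at this
      exact this.mono (Set.subset_iUnion (J i) m) (Set.subset_iUnion (J i') m')
  refine ⟨(a, b), ⟨hab, fun q q' hq => min_le_max_of_disjoint (h1 q) (h1 q') (hdisj q q' hq),
    fun hfd => ?_⟩, fun I i j => ?_⟩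
  · have hunion : ⋃ q : Fin n × Fin k, J q.1 q.2 = Set.Icc 0 1 := by
      rw [← hA.whole hfd, Set.iUnion_prod']
      exact Set.iUnion_congr fun i => (hU i).symm
    have hv := volume_iUnion_intervals (fun q => (hab q).2.1) (fun q => (hJ q.1 q.2).1) h1 h2 hdisj
    rw [hunion, Real.volume_Icc, sub_zero] at hv
    exact ((ENNReal.ofReal_eq_ofReal_iff zero_le_one
      (Finset.sum_nonneg fun q _ => sub_nonneg.2 (hab q).2.1)).1 hv).symm
  · rw [hU j, I.value_iUnion i (hJ j) (hd j), Instance.worth]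
    exact Finset.sum_congr rfl fun m _ =>
      I.value_interval i (hab (j, m)).1 (hab (j, m)).2.1 (hab (j, m)).2.2 (h1 (j, m)) (h2 (j, m))

theorem exists_allocation_of_pieces {freeDisposal : Bool} {n k : ℕ}
    {p : (Fin n × Fin k → ℝ) × (Fin n × Fin k → ℝ)} (hp : p ∈ endpoints freeDisposal n k)
    (J : Fin n × Fin k → Set ℝ) (hJ : ∀ q, (J q).OrdConnected)
    (h1 : ∀ q, Set.Ioo (p.1 q) (p.2 q) ⊆ J q) (h2 : ∀ q, J q ⊆ Set.Icc (p.1 q) (p.2 q))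
    (hd : ∀ q q', q ≠ q' → Disjoint (J q) (J q'))
    (hU : freeDisposal = false → ⋃ q, J q = Set.Icc 0 1) :
    ∃ A : Fin n → Set ℝ, IsAllocation freeDisposal k A ∧ ∀ (I : Instance n) (i j : Fin n),
      I.value i (A j) = I.worth i p j := by
  have hp1 := hp.1
  have hJ1 : ∀ q, J q ⊆ Set.Icc 0 1 := fun q =>
    (h2 q).trans (Set.Icc_subset_Icc (hp1 q).1 (hp1 q).2.2)
  have hd' : ∀ i (m m' : Fin k), m ≠ m' → Disjoint (J (i, m)) (J (i, m')) := fun i m m' h =>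
    hd _ _ fun e => h (Prod.ext_iff.1 e).2
  refine ⟨fun i => ⋃ m, J (i, m),
    ⟨fun i => ⟨fun m => J (i, m), fun m => ⟨hJ _, hJ1 _⟩, hd' i, rfl⟩, fun i j hij => ?_,
      fun hfd => ?_⟩, fun I i j => ?_⟩
  · simp only [Set.disjoint_iUnion_left, Set.disjoint_iUnion_right]
    exact fun m m' => hd _ _ fun e => hij (Prod.ext_iff.1 e).1
  · rw [← hU hfd, Set.iUnion_prod']
  · rw [I.value_iUnion i (fun m => ⟨hJ _, hJ1 _⟩) (hd' j), Instance.worth]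
    exact Finset.sum_congr rfl fun m _ =>
      I.value_interval i (hp1 _).1 (hp1 _).2.1 (hp1 _).2.2 (h1 _) (h2 _)

theorem disjoint_Ico_of_min_le_max {a b a' b' : ℝ} (h : min b b' ≤ max a a') :
    Disjoint (Set.Ico a b) (Set.Ico a' b') := by
  rw [Set.Ico_disjoint_Ico]
  exact h

/-- Half-open intervals of total length one cover the cake except for its right end. -/
theorem exists_mem_Ico_of_sum_eq_one {κ : Type*} [Fintype κ] {a b : κ → ℝ}
    (hab : ∀ q, 0 ≤ a q ∧ a q ≤ b q ∧ b q ≤ 1)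
    (hd : ∀ q q', q ≠ q' → min (b q) (b q') ≤ max (a q) (a q'))
    (hsum : ∑ q, (b q - a q) = 1) {x : ℝ} (hx : x ∈ Set.Ico (0 : ℝ) 1) :
    ∃ q, x ∈ Set.Ico (a q) (b q) := by
  by_contra hcon
  push Not at hcon
  -- A half-open piece that avoids `x` also avoids all points slightly to its right. So an interval
  -- `(x, u)` stays uncovered, and together with the pieces it would have length above `1` inside
  -- the cake.
  have hev : ∀ᶠ y in 𝓝[>] x, ∀ q, y ∉ Set.Ico (a q) (b q) := by
    refine Filter.eventually_all.2 fun q => ?_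
    by_cases hq : x < a q
    · filter_upwards [mem_nhdsWithin_of_mem_nhds (Iio_mem_nhds hq)] with y hy hmem
      exact absurd hmem.1 (not_le.2 hy)
    · filter_upwards [self_mem_nhdsWithin] with y hy hmem
      have h1 : b q ≤ x := by
        by_contra h
        exact hcon q ⟨not_lt.1 hq, not_le.1 h⟩
      exact absurd (h1.trans_lt hy) (not_lt.2 hmem.2.le)
  have hev1 : ∀ᶠ y in 𝓝[>] x, y < 1 := mem_nhdsWithin_of_mem_nhds (Iio_mem_nhds hx.2)
  obtain ⟨u, hu, hsub⟩ := mem_nhdsGT_iff_exists_Ioo_subset.1 (hev.and hev1)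
  have hvol := volume_iUnion_intervals (J := fun q => Set.Ico (a q) (b q)) (fun q => (hab q).2.1)
    (fun q => Set.ordConnected_Ico) (fun q => Set.Ioo_subset_Ico_self)
    (fun q => Set.Ico_subset_Icc_self) (fun q q' h => disjoint_Ico_of_min_le_max (hd q q' h))
  have hdisj : Disjoint (⋃ q, Set.Ico (a q) (b q)) (Set.Ioo x u) := by
    rw [Set.disjoint_right]
    intro y hy hmem
    obtain ⟨q, hq⟩ := Set.mem_iUnion.1 hmem
    exact (hsub hy).1 q hq
  have hle : volume ((⋃ q, Set.Ico (a q) (b q)) ∪ Set.Ioo x u) ≤ volume (Set.Icc (0 : ℝ) 1) := by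
    refine measure_mono (Set.union_subset (Set.iUnion_subset fun q => ?_) fun y hy => ?_)
    · exact Set.Ico_subset_Icc_self.trans (Set.Icc_subset_Icc (hab q).1 (hab q).2.2)
    · exact ⟨hx.1.trans hy.1.le, (hsub hy).2.le⟩
  rw [measure_union hdisj measurableSet_Ioo, hvol, hsum, Real.volume_Ioo, Real.volume_Icc, sub_zero,
    ← ENNReal.ofReal_add zero_le_one (sub_nonneg.2 (le_of_lt hu)),
    ENNReal.ofReal_le_ofReal_iff zero_le_one] at hle
  have : x < u := hu
  linarith

/-- Half-open pieces are disjoint and, when their total length is one, miss only the point `1`. If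
nothing may be discarded, that point is attached to one piece ending there. -/
theorem exists_allocation_of_endpoints {freeDisposal : Bool} {n k : ℕ}
    {p : (Fin n × Fin k → ℝ) × (Fin n × Fin k → ℝ)} (hp : p ∈ endpoints freeDisposal n k) :
    ∃ A : Fin n → Set ℝ, IsAllocation freeDisposal k A ∧ ∀ (I : Instance n) (i j : Fin n),
      I.value i (A j) = I.worth i p j := by
  classical
  obtain ⟨hp1, hp2, hp3⟩ := id hp
  have hdIco : ∀ q q', q ≠ q' → Disjoint (Set.Ico (p.1 q) (p.2 q)) (Set.Ico (p.1 q') (p.2 q')) :=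
    fun q q' h => disjoint_Ico_of_min_le_max (hp2 q q' h)
  cases freeDisposal with
  | true =>
    exact exists_allocation_of_pieces hp (fun q => Set.Ico (p.1 q) (p.2 q))
      (fun q => Set.ordConnected_Ico) (fun q => Set.Ioo_subset_Ico_self)
      (fun q => Set.Ico_subset_Icc_self) hdIco (fun h => by simp at h)
  | false =>
    have hcover : ∀ x ∈ Set.Ico (0 : ℝ) 1, ∃ q, x ∈ Set.Ico (p.1 q) (p.2 q) := fun x hx =>
      exists_mem_Ico_of_sum_eq_one hp1 hp2 (hp3 rfl) hx
    -- Otherwise the points just to the left of `1` would be uncovered.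
    obtain ⟨q₀, ha₀, hb₀⟩ : ∃ q, p.1 q < 1 ∧ p.2 q = 1 := by
      by_contra hcon
      push Not at hcon
      have hev : ∀ᶠ y in 𝓝[<] (1 : ℝ), ∀ q, y ∉ Set.Ico (p.1 q) (p.2 q) := by
        refine Filter.eventually_all.2 fun q => ?_
        by_cases hq : p.1 q < 1
        · filter_upwards [mem_nhdsWithin_of_mem_nhds
            (Ioi_mem_nhds (lt_of_le_of_ne (hp1 q).2.2 (hcon q hq)))] with y hy hmem
          exact absurd hmem.2 (not_lt.2 (le_of_lt hy))
        · filter_upwards [self_mem_nhdsWithin] with y hy hmem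
          exact hq (hmem.1.trans_lt hy)
      have hev1 : ∀ᶠ y in 𝓝[<] (1 : ℝ), 0 < y :=
        mem_nhdsWithin_of_mem_nhds (Ioi_mem_nhds zero_lt_one)
      obtain ⟨y, hy, hy0, hy1⟩ := (hev.and (hev1.and self_mem_nhdsWithin)).exists
      obtain ⟨q, hq⟩ := hcover y ⟨hy0.le, hy1⟩
      exact hy q hq
    let J : Fin n × Fin k → Set ℝ := fun q =>
      if q = q₀ then Set.Icc (p.1 q) (p.2 q) else Set.Ico (p.1 q) (p.2 q)
    have hmem : ∀ q x, x ∈ J q ↔ x ∈ Set.Ico (p.1 q) (p.2 q) ∨ (q = q₀ ∧ x = 1) := by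
      intro q x
      by_cases hq : q = q₀
      · subst hq
        simp only [J, if_true, true_and, Set.mem_Icc, Set.mem_Ico, hb₀]
        constructor
        · rintro ⟨h1, h2⟩
          rcases h2.lt_or_eq with h | h
          · exact Or.inl ⟨h1, h⟩
          · exact Or.inr h
        · rintro (⟨h1, h2⟩ | rfl)
          · exact ⟨h1, h2.le⟩
          · exact ⟨ha₀.le, le_rfl⟩
      · simp [J, hq]
    refine exists_allocation_of_pieces hp J (fun q => ?_) (fun q => ?_) (fun q => ?_)
      (fun q q' hqq => ?_) (fun _ => ?_)
    · simp only [J]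
      split_ifs
      · exact Set.ordConnected_Icc
      · exact Set.ordConnected_Ico
    · exact fun x hx => (hmem q x).2 (Or.inl (Set.Ioo_subset_Ico_self hx))
    · simp only [J]
      split_ifs
      · exact subset_rfl
      · exact Set.Ico_subset_Icc_self
    · have hno : ∀ q, (1 : ℝ) ∉ Set.Ico (p.1 q) (p.2 q) := fun q h =>
        absurd h.2 (not_lt.2 (hp1 q).2.2)
      rw [Set.disjoint_left]
      intro x hx hx'
      rcases (hmem q x).1 hx with h | ⟨h, rfl⟩ <;> rcases (hmem q' _).1 hx' with h' | ⟨h', h''⟩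
      · exact Set.disjoint_left.1 (hdIco q q' hqq) h h'
      · exact hno q (h'' ▸ h)
      · exact hno q' h'
      · exact hqq (h.trans h'.symm)
    · ext x
      rw [Set.mem_iUnion]
      constructor
      · rintro ⟨q, hq⟩
        rcases (hmem q x).1 hq with h | ⟨-, rfl⟩
        · exact ⟨(hp1 q).1.trans h.1, h.2.le.trans (hp1 q).2.2⟩
        · exact ⟨zero_le_one, le_rfl⟩
      · rintro ⟨h0, h1⟩
        rcases h1.lt_or_eq with h | h
        · obtain ⟨q, hq⟩ := hcover x ⟨h0, h⟩
          exact ⟨q, (hmem q x).2 (Or.inl hq)⟩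
        · exact ⟨q₀, (hmem q₀ x).2 (Or.inr ⟨rfl, h⟩)⟩

/-! ### The optimal egalitarian welfare -/

/-- This moves the optimisation from arbitrary families of sets to a compact set of endpoints. -/
theorem Instance.image_egalitarianWelfare {n : ℕ} (I : Instance n) (freeDisposal : Bool) (k : ℕ) :
    I.egalitarianWelfare '' I.allocationsF freeDisposal k =
      (fun p => ⨅ i, I.worth i p i) ''
        {p ∈ endpoints freeDisposal n k | ∀ i j, I.worth i p j ≤ I.worth i p i} := by
  ext w
  constructor
  · rintro ⟨A, ⟨hA, hEF⟩, rfl⟩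
    obtain ⟨p, hp, hval⟩ := hA.exists_endpoints
    refine ⟨p, ⟨hp, fun i j => ?_⟩, ?_⟩
    · rw [← hval, ← hval]; exact hEF i j
    · simp only [Instance.egalitarianWelfare, hval]
  · rintro ⟨p, ⟨hp, hEF⟩, rfl⟩
    obtain ⟨A, hA, hval⟩ := exists_allocation_of_endpoints hp
    refine ⟨A, ⟨hA, fun i j => ?_⟩, ?_⟩
    · rw [hval, hval]; exact hEF i j
    · simp only [Instance.egalitarianWelfare, hval]

/-- There is an envy-free allocation of the whole cake with a single piece for every player. -/
theorem Instance.exists_envyFree_endpoints {n k : ℕ} (hn : 1 ≤ n) (hk : 1 ≤ k) (I : Instance n)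
    (freeDisposal : Bool) :
    ∃ p ∈ endpoints freeDisposal n k, (∀ i j, I.worth i p j ≤ I.worth i p i) ∧
      ∀ i, 1 / (n : ℝ) ≤ I.worth i p i := by
  obtain ⟨s, hs, hs0, hsn, σ, hσ⟩ := exists_envyFree_cuts hn I.cdf I.continuous_cdf I.cdf_zero
    I.cdf_one
  obtain ⟨k, rfl⟩ : ∃ l, k = l + 1 := ⟨k - 1, by omega⟩
  have h01 : ∀ l ≤ n, 0 ≤ s l ∧ s l ≤ 1 := fun l hl =>
    ⟨hs0.symm.trans_le (hs (Nat.zero_le l)), (hs hl).trans_eq hsn⟩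
  -- Player `j` gets the interval number `σ j` as piece `0`; all further pieces are degenerate at
  -- `0`.
  let p : (Fin n × Fin (k + 1) → ℝ) × (Fin n × Fin (k + 1) → ℝ) :=
    (fun q => if q.2 = 0 then s (σ q.1) else 0, fun q => if q.2 = 0 then s (σ q.1 + 1) else 0)
  have hbounds : ∀ q, 0 ≤ p.1 q ∧ p.1 q ≤ p.2 q ∧ p.2 q ≤ 1 := fun q => by
    simp only [p]
    split_ifs
    · exact ⟨(h01 _ (σ q.1).2.le).1, hs (Nat.le_succ _), (h01 _ (σ q.1).2).2⟩
    · exact ⟨le_rfl, le_rfl, zero_le_one⟩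
  have hworth : ∀ i j, I.worth i p j = I.cdf i (s (σ j + 1)) - I.cdf i (s (σ j)) := fun i j => by
    rw [Instance.worth, Fin.sum_univ_succ]
    simp [p]
  have hsum : ∀ f : ℝ → ℝ, ∑ j : Fin n, (f (s (σ j + 1)) - f (s (σ j))) = f 1 - f 0 := fun f => by
    rw [Equiv.sum_comp σ (fun j => f (s (j + 1)) - f (s j)),
      Fin.sum_univ_eq_sum_range (fun l => f (s (l + 1)) - f (s l)) n,
      Finset.sum_range_sub (fun l => f (s l)), hs0, hsn]
  refine ⟨p, ⟨hbounds, ?_, fun _ => ?_⟩, fun i j => ?_, fun i => ?_⟩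
  · rintro ⟨i, m⟩ ⟨i', m'⟩ hq
    have hb := hbounds (i, m)
    have hb' := hbounds (i', m')
    by_cases hm : m = 0
    · by_cases hm' : m' = 0
      · subst hm hm'
        simp only [p, if_true]
        have hi : σ i ≠ σ i' := fun h => hq (by rw [σ.injective h])
        rcases lt_or_gt_of_ne hi with h | h
        · exact (min_le_left _ _).trans ((hs (Nat.succ_le_of_lt h)).trans (le_max_right _ _))
        · exact (min_le_right _ _).trans ((hs (Nat.succ_le_of_lt h)).trans (le_max_left _ _))
      · refine (min_le_right _ _).trans (le_trans ?_ (le_max_left _ _))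
        simpa [p, hm'] using hb.1
    · refine (min_le_left _ _).trans (le_trans ?_ (le_max_right _ _))
      simpa [p, hm] using hb'.1
  · have := hsum id
    simp only [id, sub_zero] at this
    rw [← this, Fintype.sum_prod_type]
    refine Finset.sum_congr rfl fun j _ => ?_
    rw [Fin.sum_univ_succ]
    simp [p]
  · rw [hworth, hworth]
    exact hσ i (σ j)
  · have h1 := hsum (I.cdf i)
    rw [I.cdf_one, I.cdf_zero, sub_zero] at h1
    have h2 : ∑ j : Fin n, (I.cdf i (s (σ j + 1)) - I.cdf i (s (σ j))) ≤
        ∑ _j : Fin n, (I.cdf i (s (σ i + 1)) - I.cdf i (s (σ i))) :=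
      Finset.sum_le_sum fun j _ => hσ i (σ j)
    rw [h1, Finset.sum_const, Finset.card_univ, Fintype.card_fin, nsmul_eq_mul] at h2
    have hnpos : (0 : ℝ) < n := by exact_mod_cast hn
    rw [hworth, div_le_iff₀ hnpos, mul_comm]
    exact h2

/-- Envy-freeness is closed in the compact set of endpoints, welfare is a minimum of finitely many
continuous functions, and the one-interval division shows that the set is nonempty. -/
theorem Instance.isGreatest_optEgalitarianF {n k : ℕ} (hn : 1 ≤ n) (hk : 1 ≤ k) (I : Instance n)
    (freeDisposal : Bool) :
    IsGreatest (I.egalitarianWelfare '' I.allocationsF freeDisposal k)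
      (I.optEgalitarianF freeDisposal k) := by
  have : Nonempty (Fin n) := ⟨⟨0, hn⟩⟩
  rw [Instance.optEgalitarianF, I.image_egalitarianWelfare]
  apply IsCompact.isGreatest_sSup
  · have hclosed : IsClosed {p : (Fin n × Fin k → ℝ) × (Fin n × Fin k → ℝ) |
        ∀ i j, I.worth i p j ≤ I.worth i p i} := by
      simp only [Set.ofPred_forall]
      exact isClosed_iInter fun i => isClosed_iInter fun j =>
        isClosed_le (I.continuous_worth i j) (I.continuous_worth i i)
    refine ((isCompact_endpoints freeDisposal n k).inter_right hclosed).image ?_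
    simp only [← Finset.inf'_univ_eq_ciInf]
    exact Continuous.finset_inf'_apply _ fun i _ => I.continuous_worth i i
  · obtain ⟨p, hp, hEF, -⟩ := I.exists_envyFree_endpoints hn hk freeDisposal
    exact ⟨_, p, ⟨hp, hEF⟩, rfl⟩

theorem Instance.one_div_le_optEgalitarianF {n k : ℕ} (hn : 1 ≤ n) (hk : 1 ≤ k) (I : Instance n)
    (freeDisposal : Bool) : 1 / (n : ℝ) ≤ I.optEgalitarianF freeDisposal k := by
  have : Nonempty (Fin n) := ⟨⟨0, hn⟩⟩
  obtain ⟨p, hp, hEF, h⟩ := I.exists_envyFree_endpoints hn hk freeDisposal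
  refine (le_ciInf h).trans ((I.isGreatest_optEgalitarianF hn hk freeDisposal).2 ?_)
  rw [I.image_egalitarianWelfare]
  exact ⟨p, ⟨hp, hEF⟩, rfl⟩

theorem Instance.egalitarianWelfare_le {n : ℕ} (I : Instance n) (A : Fin n → Set ℝ) (i : Fin n) :
    I.egalitarianWelfare A ≤ I.value i (A i) :=
  ciInf_le (Set.finite_range _).bddBelow i

theorem Instance.optEgalitarianF_le_one {n k : ℕ} (hn : 1 ≤ n) (hk : 1 ≤ k) (I : Instance n)
    (freeDisposal : Bool) : I.optEgalitarianF freeDisposal k ≤ 1 := by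
  obtain ⟨A, ⟨hA, -⟩, h⟩ := (I.isGreatest_optEgalitarianF hn hk freeDisposal).1
  rw [← h]
  exact (I.egalitarianWelfare_le A ⟨0, hn⟩).trans (I.value_le_one _ (hA.portion _))

theorem Instance.gainEF_le {n k : ℕ} (hn : 1 ≤ n) (hk : 1 ≤ k) (I : Instance n)
    (freeDisposal : Bool) : I.gainEF freeDisposal k ≤ n := by
  have hnpos : (0 : ℝ) < n := by exact_mod_cast hn
  have h1 := I.one_div_le_optEgalitarianF hn le_rfl freeDisposal
  have h2 := I.optEgalitarianF_le_one hn hk freeDisposal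
  rw [Instance.gainEF, div_le_iff₀ (lt_of_lt_of_le (by positivity) h1)]
  calc I.optEgalitarianF freeDisposal k ≤ 1 := h2
    _ = n * (1 / n) := (mul_one_div_cancel hnpos.ne').symm
    _ ≤ n * I.optEgalitarianF freeDisposal 1 := by gcongr

/-! ### An instance with a large gain -/

theorem exists_bump {a b : ℝ} (hab : a < b) :
    ∃ f : ℝ → ℝ, Continuous f ∧ (∀ x, 0 ≤ f x) ∧ (∀ x, x ∉ Set.Ioo a b → f x = 0) ∧
      Integrable f ∧ ∫ x, f x = 1 := by
  let φ : ContDiffBump ((a + b) / 2) := ⟨(b - a) / 4, (b - a) / 2, by linarith, by linarith⟩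
  refine ⟨φ.normed volume, φ.continuous_normed, φ.nonneg_normed, fun x hx => ?_,
    φ.integrable_normed, φ.integral_normed⟩
  by_contra h
  have h1 : x ∈ Function.support (φ.normed volume) := h
  rw [φ.support_normed_eq, Real.ball_eq_Ioo] at h1
  refine hx ⟨?_, ?_⟩
  · have := h1.1; simp only [φ] at this; linarith
  · have := h1.2; simp only [φ] at this; linarith

/-- The interior of the `t`-th of `N` equal cells of the cake. -/
def cell (N t : ℕ) : Set ℝ := Set.Ioo ((t : ℝ) / N) ((t + 1 : ℝ) / N)

/-- An instance in which the values of `N` equal cells are prescribed. -/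
theorem exists_instance_of_cellValues {n N : ℕ} (hN : 0 < N) (w : Fin n → ℕ → ℝ)
    (hw : ∀ i t, 0 ≤ w i t) (hw1 : ∀ i, ∑ t ∈ Finset.range N, w i t = 1) :
    ∃ I : Instance n, (∀ i, ∀ t ≤ N, I.cdf i ((t : ℝ) / N) = ∑ s ∈ Finset.range t, w i s) ∧
      ∀ S, ∃ c : ℕ → ℝ, (∀ t, c t ≤ 1 ∧ (Disjoint S (cell N t) → c t = 0)) ∧
        ∀ i, I.value i S = ∑ t ∈ Finset.range N, w i t * c t := by
  have hNpos : (0 : ℝ) < N := by exact_mod_cast hN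
  -- One bump of mass `1` per cell; densities are weighted sums of bumps. The coefficient `c t` is
  -- the mass of bump `t` on `S`, hence the same for all players.
  choose f hfc hf0 hfout hfint hf1 using fun t : ℕ =>
    exists_bump (a := (t : ℝ) / N) (b := (t + 1 : ℝ) / N) (by gcongr; linarith)
  have hin : ∀ S t, cell N t ⊆ S → ∫ x in S, f t x = 1 := fun S t h => by
    rw [setIntegral_eq_integral_of_forall_compl_eq_zero fun x hx => hfout t x fun h' => hx (h h')]
    exact hf1 t
  have hout : ∀ S t, Disjoint S (cell N t) → ∫ x in S, f t x = 0 := fun S t h =>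
    setIntegral_eq_zero_of_forall_eq_zero fun x hx => hfout t x (Set.disjoint_left.1 h hx)
  have hsum : ∀ i S, ∫ x in S, ∑ t ∈ Finset.range N, w i t * f t x =
      ∑ t ∈ Finset.range N, w i t * ∫ x in S, f t x := fun i S => by
    rw [integral_finsetSum _ fun t _ => ((hfint t).const_mul _).integrableOn]
    exact Finset.sum_congr rfl fun t _ => integral_const_mul _ _
  have hcell : ∀ t u v : ℕ, u ≤ t → t < v → cell N t ⊆ Set.Ioo ((u : ℝ) / N) ((v : ℝ) / N) := by
    intro t u v hu hv
    have h1 : (u : ℝ) ≤ t := by exact_mod_cast hu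
    have h2 : (t + 1 : ℝ) ≤ v := by exact_mod_cast hv
    exact Set.Ioo_subset_Ioo (by gcongr) (by gcongr)
  let I : Instance n :=
    { density := fun i x => ∑ t ∈ Finset.range N, w i t * f t x
      continuousOn := fun i =>
        (continuous_finsetSum _ fun t _ => continuous_const.mul (hfc t)).continuousOn
      nonneg := fun i x _ => Finset.sum_nonneg fun t _ => mul_nonneg (hw i t) (hf0 t x)
      normalized := fun i => by
        refine (hsum i _).trans (Eq.trans ?_ (hw1 i))
        refine Finset.sum_congr rfl fun t ht => ?_
        rw [hin, mul_one]
        have := hcell t 0 N (Nat.zero_le _) (Finset.mem_range.1 ht)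
        rw [Nat.cast_zero, zero_div, div_self hNpos.ne'] at this
        exact this.trans Set.Ioo_subset_Icc_self }
  refine ⟨I, fun i t ht => ?_, fun S => ⟨fun t => ∫ x in S, f t x, fun t => ⟨?_, hout S t⟩,
    fun i => hsum i S⟩⟩
  · have htN : (t : ℝ) ≤ N := by exact_mod_cast ht
    have h := I.value_interval i (S := Set.Ioo 0 ((t : ℝ) / N)) le_rfl (by positivity)
      ((div_le_one hNpos).2 htN) subset_rfl Set.Ioo_subset_Icc_self
    rw [I.cdf_zero, sub_zero] at h
    rw [← h]
    refine (hsum i _).trans ?_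
    rw [← Finset.sum_subset (Finset.range_mono ht)]
    · refine Finset.sum_congr rfl fun s hs => ?_
      rw [hin, mul_one]
      simpa using hcell s 0 t (Nat.zero_le _) (Finset.mem_range.1 hs)
    · intro s _ hs
      rw [hout, mul_zero]
      refine Set.disjoint_left.2 fun x hx hx' => ?_
      have h1 : (t : ℝ) ≤ s := by exact_mod_cast not_lt.1 fun h => hs (Finset.mem_range.2 h)
      have h2 : (t : ℝ) / N ≤ s / N := by gcongr
      exact absurd (hx.2.trans_le h2) (not_lt.2 (le_of_lt hx'.1))
  · exact (setIntegral_le_integral (hfint t) (Filter.Eventually.of_forall (hf0 t))).trans_eq (hf1 t)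

/-- Player `0` spreads their value evenly over the cells `0, 2, …, 2 (m - 1)`, and player `i ≥ 1`
only values the cell `2 i - 1`. -/
def cellValue (m i t : ℕ) : ℝ :=
  if i = 0 then (if Even t ∧ t < 2 * m then 1 / (m : ℝ) else 0) else if t + 1 = 2 * i then 1 else 0

theorem cellValue_nonneg (m i t : ℕ) : 0 ≤ cellValue m i t := by
  rw [cellValue]
  split_ifs <;> positivity

theorem sum_cellValue_of_pos (m : ℕ) {i : ℕ} (hi : 0 < i) (t : ℕ) :
    ∑ s ∈ Finset.range t, cellValue m i s = if 2 * i ≤ t then 1 else 0 := by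
  have h : ∀ s, cellValue m i s = if s = 2 * i - 1 then 1 else 0 := fun s => by
    rw [cellValue, if_neg hi.ne']
    congr 1
    apply propext
    omega
  simp only [h, Finset.sum_ite_eq', Finset.mem_range]
  congr 1
  apply propext
  omega

theorem cellValue_zero_two_mul (m l : ℕ) :
    cellValue m 0 (2 * l) = if l < m then 1 / (m : ℝ) else 0 := by
  simp [cellValue]

theorem cellValue_zero_odd (m l : ℕ) : cellValue m 0 (2 * l + 1) = 0 := by
  simp [cellValue]

theorem sum_range_ite_lt (k m : ℕ) (x : ℝ) :
    ∑ l ∈ Finset.range k, (if l < m then x else 0) = (min k m : ℕ) * x := by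
  rw [← Finset.sum_filter, Finset.sum_const, nsmul_eq_mul]
  congr 2
  rw [← Finset.card_range (min k m)]
  congr 1
  ext l
  simp

theorem sum_cellValue_zero {m r : ℕ} (hm : 1 ≤ m) (hr : m ≤ r + 1) :
    ∑ t ∈ Finset.range (2 * r + 1), cellValue m 0 t = 1 := by
  have hmpos : (0 : ℝ) < m := by exact_mod_cast hm
  have h : ∀ r, ∑ t ∈ Finset.range (2 * r), cellValue m 0 t =
      ∑ l ∈ Finset.range r, (if l < m then 1 / (m : ℝ) else 0) := by
    intro r
    induction r with
    | zero => simp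
    | succ r ih =>
      rw [Nat.mul_succ, Finset.sum_range_succ, Finset.sum_range_succ, ih, Finset.sum_range_succ,
        cellValue_zero_odd, cellValue_zero_two_mul, add_zero]
  rw [Finset.sum_range_succ, h, cellValue_zero_two_mul, ← Finset.sum_range_succ, sum_range_ite_lt,
    min_eq_right hr, mul_one_div_cancel hmpos.ne']

/-- Left ends, in units of cells, of the pieces giving all players their entire value. -/
def leftEnd (m i l : ℕ) : ℕ :=
  if i = 0 then (if l < m then 2 * l else 0) else if l = 0 then 2 * i - 1 else 0

/-- Right ends, in units of cells, of the pieces giving all players their entire value. -/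
def rightEnd (m i l : ℕ) : ℕ :=
  if i = 0 then (if l < m then 2 * l + 1 else 0)
  else if l = 0 then (if i < m then 2 * i else 2 * i + 1) else 0

theorem leftEnd_le_rightEnd (m i l : ℕ) : leftEnd m i l ≤ rightEnd m i l := by
  rw [leftEnd, rightEnd]
  split_ifs <;> omega

theorem rightEnd_le {m r i : ℕ} (hm : m ≤ r + 1) (hi : i ≤ r) (l : ℕ) :
    rightEnd m i l ≤ 2 * r + 1 := by
  rw [rightEnd]
  split_ifs <;> omega

/-- The four alternatives are the ways in which the smaller right end can be at most the larger left
end: one piece is degenerate, or one lies to the left of the other. -/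
theorem rightEnd_le_leftEnd {m i l i' l' : ℕ} (h : i ≠ i' ∨ l ≠ l') :
    rightEnd m i l ≤ leftEnd m i l ∨ rightEnd m i' l' ≤ leftEnd m i' l' ∨
      rightEnd m i l ≤ leftEnd m i' l' ∨ rightEnd m i' l' ≤ leftEnd m i l := by
  rw [leftEnd, rightEnd, leftEnd, rightEnd]
  split_ifs <;> omega

/-- No cell is left over: for `i ≥ m` player `i` also takes the cell `2 * i`, which nobody values.
This covers the case without free disposal. -/
theorem sum_lengths {m k r : ℕ} (hm1 : 1 ≤ m) (hmk : m ≤ k) (hm : m ≤ r + 1) :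
    ∑ i ∈ Finset.range (r + 1), ∑ l ∈ Finset.range k,
      ((rightEnd m i l : ℝ) - leftEnd m i l) = 2 * r + 1 := by
  have h0 : ∑ l ∈ Finset.range k, ((rightEnd m 0 l : ℝ) - leftEnd m 0 l) = m := by
    have : ∀ l, (rightEnd m 0 l : ℝ) - leftEnd m 0 l = if l < m then 1 else 0 := fun l => by
      rw [leftEnd, rightEnd, if_pos rfl, if_pos rfl]
      split_ifs
      · push_cast; ring
      · simp
    simp only [this, sum_range_ite_lt, min_eq_right hmk, mul_one]
  have hpos : ∀ i, ∑ l ∈ Finset.range k, ((rightEnd m (i + 1) l : ℝ) - leftEnd m (i + 1) l) =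
      if i + 1 < m then 1 else 2 := fun i => by
    rw [Finset.sum_eq_single_of_mem 0 (Finset.mem_range.2 (hm1.trans hmk)) fun l _ hl => by
      simp [leftEnd, rightEnd, hl]]
    have : 2 * (i + 1) - 1 = 2 * i + 1 := by omega
    rw [leftEnd, rightEnd, if_neg i.succ_ne_zero, if_neg i.succ_ne_zero, if_pos rfl, if_pos rfl, this]
    split_ifs
    · push_cast; ring
    · push_cast; ring
  -- The minima extend the count to small `r`, where `m ≤ r + 1` fails, so that induction on `r` can
  -- start at `0`.
  have key : ∀ r : ℕ, ∑ i ∈ Finset.range r, (if i + 1 < m then (1 : ℝ) else 2) +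
      (min (r + 1) m : ℕ) = 2 * r + (min 1 m : ℕ) := by
    intro r
    induction r with
    | zero => simp
    | succ r ih =>
      rw [Finset.sum_range_succ]
      split_ifs with h
      · rw [min_eq_left (by omega)] at ih
        rw [min_eq_left (by omega)]
        push_cast at ih ⊢
        linarith
      · rw [min_eq_right (by omega)] at ih
        rw [min_eq_right (by omega)]
        push_cast at ih ⊢
        linarith
  rw [Finset.sum_range_succ', h0, Finset.sum_congr rfl fun i _ => hpos i]
  have := key r
  rw [min_eq_right hm, min_eq_left hm1] at this
  push_cast at this
  linarith

/-- For `m ≤ n`, some instance allows all players their entire value with `m` pieces each, while a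
single piece each only gives an egalitarian welfare of at most `1 / m`. -/
theorem exists_instance_le_gainEF {n m k : ℕ} (hm : 1 ≤ m) (hmn : m ≤ n) (hmk : m ≤ k)
    (freeDisposal : Bool) : ∃ I : Instance n, (m : ℝ) ≤ I.gainEF freeDisposal k := by
  have hn : 1 ≤ n := hm.trans hmn
  have hk : 1 ≤ k := hm.trans hmk
  obtain ⟨r, rfl⟩ : ∃ r, n = r + 1 := ⟨n - 1, by omega⟩
  have hmpos : (0 : ℝ) < m := by exact_mod_cast hm
  have hNpos : (0 : ℝ) < (2 * r + 1 : ℕ) := by positivity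
  obtain ⟨I, hcdf, hval⟩ := exists_instance_of_cellValues (n := r + 1) (N := 2 * r + 1) (by omega)
    (fun i t => cellValue m i t) (fun i t => cellValue_nonneg m i t) (fun i => by
      by_cases hi : (i : ℕ) = 0
      · simp only [hi]
        exact sum_cellValue_zero hm hmn
      · rw [sum_cellValue_of_pos m (Nat.pos_of_ne_zero hi), if_pos]
        have := i.2
        omega)
  refine ⟨I, ?_⟩
  have hlow : 1 ≤ I.optEgalitarianF freeDisposal k := by
    let p : (Fin (r + 1) × Fin k → ℝ) × (Fin (r + 1) × Fin k → ℝ) :=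
      (fun q => (leftEnd m q.1 q.2 : ℝ) / (2 * r + 1 : ℕ),
        fun q => (rightEnd m q.1 q.2 : ℝ) / (2 * r + 1 : ℕ))
    have hrle : ∀ q : Fin (r + 1) × Fin k, rightEnd m q.1 q.2 ≤ 2 * r + 1 := fun q =>
      rightEnd_le hmn (Nat.lt_succ_iff.1 q.1.2) _
    have hp : p ∈ endpoints freeDisposal (r + 1) k := by
      refine ⟨fun q => ⟨by positivity, ?_, ?_⟩, fun q q' hq => ?_, fun _ => ?_⟩
      · have : (leftEnd m q.1 q.2 : ℝ) ≤ rightEnd m q.1 q.2 := by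
          exact_mod_cast leftEnd_le_rightEnd m q.1 q.2
        simp only [p]
        gcongr
      · have : (rightEnd m q.1 q.2 : ℝ) ≤ (2 * r + 1 : ℕ) := by exact_mod_cast hrle q
        exact (div_le_one hNpos).2 this
      · have hdiv : ∀ a b : ℕ, a ≤ b → (a : ℝ) / (2 * r + 1 : ℕ) ≤ (b : ℝ) / (2 * r + 1 : ℕ) :=
          fun a b h => by
            have : (a : ℝ) ≤ b := by exact_mod_cast h
            gcongr
        have hne : (q.1 : ℕ) ≠ q'.1 ∨ (q.2 : ℕ) ≠ q'.2 := by
          by_contra hcon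
          push Not at hcon
          exact hq (Prod.ext (Fin.ext hcon.1) (Fin.ext hcon.2))
        rcases rightEnd_le_leftEnd (m := m) hne with h | h | h | h
        · exact (min_le_left _ _).trans ((hdiv _ _ h).trans (le_max_left _ _))
        · exact (min_le_right _ _).trans ((hdiv _ _ h).trans (le_max_right _ _))
        · exact (min_le_left _ _).trans ((hdiv _ _ h).trans (le_max_right _ _))
        · exact (min_le_right _ _).trans ((hdiv _ _ h).trans (le_max_left _ _))
      · have h := sum_lengths hm hmk hmn
        simp only [p, ← sub_div]
        rw [← Finset.sum_div, div_eq_one_iff_eq hNpos.ne', Fintype.sum_prod_type]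
        push_cast
        rw [← h, ← Fin.sum_univ_eq_sum_range
          (fun i => ∑ l ∈ Finset.range k, ((rightEnd m i l : ℝ) - leftEnd m i l))]
        refine Finset.sum_congr rfl fun i _ => ?_
        rw [← Fin.sum_univ_eq_sum_range (fun l => ((rightEnd m i l : ℝ) - leftEnd m i l))]
    have hworth : ∀ i, I.worth i p i = 1 := by
      intro i
      have h1 : I.worth i p i = ∑ l : Fin k,
          (∑ s ∈ Finset.range (rightEnd m i l), cellValue m i s -
            ∑ s ∈ Finset.range (leftEnd m i l), cellValue m i s) :=
        Finset.sum_congr rfl fun l _ => by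
          rw [← hcdf i _ (hrle (i, l)),
            ← hcdf i _ ((leftEnd_le_rightEnd m i l).trans (hrle (i, l)))]
      rw [h1, Fin.sum_univ_eq_sum_range (fun l =>
        (∑ s ∈ Finset.range (rightEnd m i l), cellValue m i s -
            ∑ s ∈ Finset.range (leftEnd m i l), cellValue m i s)) k]
      by_cases hi : (i : ℕ) = 0
      · have h2 : ∀ l, ∑ s ∈ Finset.range (rightEnd m i l), cellValue m i s -
            ∑ s ∈ Finset.range (leftEnd m i l), cellValue m i s =
            if l < m then 1 / (m : ℝ) else 0 := fun l => by
          rw [hi, leftEnd, rightEnd, if_pos rfl, if_pos rfl]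
          split_ifs with hl
          · rw [Finset.sum_range_succ, cellValue_zero_two_mul, if_pos hl, add_sub_cancel_left]
          · exact sub_self _
        simp only [h2, sum_range_ite_lt, min_eq_right hmk]
        exact mul_one_div_cancel hmpos.ne'
      · have hipos := Nat.pos_of_ne_zero hi
        simp only [sum_cellValue_of_pos m hipos]
        rw [Finset.sum_eq_single_of_mem 0 (Finset.mem_range.2 hk) fun l _ hl => by
          simp [leftEnd, rightEnd, hi, hl]]
        rw [leftEnd, rightEnd, if_neg hi, if_neg hi, if_pos rfl, if_pos rfl, if_pos, if_neg,
          sub_zero]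
        · omega
        · split_ifs <;> omega
    obtain ⟨A, hA, hAval⟩ := exists_allocation_of_endpoints hp
    have hone : ∀ i, I.value i (A i) = 1 := fun i => by rw [hAval, hworth]
    -- Nobody can envy while holding value `1`, the value of the entire cake.
    have hEF : A ∈ I.allocationsF freeDisposal k := ⟨hA, fun i j => by
      rw [hone i]; exact I.value_le_one i (hA.portion j)⟩
    refine le_trans ?_ ((I.isGreatest_optEgalitarianF hn hk freeDisposal).2
      (Set.mem_image_of_mem _ hEF))
    exact le_ciInf fun i => (hone i).ge
  have hupp : I.optEgalitarianF freeDisposal 1 ≤ 1 / m := by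
    obtain ⟨A, ⟨hA, -⟩, h⟩ := (I.isGreatest_optEgalitarianF hn le_rfl freeDisposal).1
    rw [← h]
    have hconn : (A 0).OrdConnected := by
      obtain ⟨J, hJ, -, hU⟩ := hA.portion 0
      rw [hU, Set.iUnion_eq_const (s := J 0) fun m => by rw [Subsingleton.elim m 0]]
      exact (hJ 0).1
    obtain ⟨c, hc, hcval⟩ := hval (A 0)
    have hmeet : ∀ t, c t ≠ 0 → ∃ x ∈ A 0, x ∈ cell (2 * r + 1) t := fun t ht =>
      Set.not_disjoint_iff.1 fun hd => ht ((hc t).2 hd)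
    -- If the interval of player `0` reaches two valued cells, it contains the odd cell `2 * l + 1`,
    -- the whole value of player `l + 1`, whose welfare is then `0`. Otherwise at most one cell
    -- contributes, and it is worth at most `1/m`.
    by_cases hcase : ∃ l l', l < l' ∧ l' < m ∧ c (2 * l) ≠ 0 ∧ c (2 * l') ≠ 0
    · obtain ⟨l, l', hll, hlm, hcl, hcl'⟩ := hcase
      obtain ⟨x, hx, hxc⟩ := hmeet _ hcl
      obtain ⟨y, hy, hyc⟩ := hmeet _ hcl'
      let i : Fin (r + 1) := ⟨l + 1, by omega⟩
      have hsub : cell (2 * r + 1) (2 * l + 1) ⊆ A 0 := fun z hz => by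
        refine hconn.out hx hy ⟨?_, ?_⟩
        · have h1 := hxc.2
          have h2 := hz.1
          push_cast at h1 h2
          exact (h1.trans h2).le
        · have h1 := hyc.1
          have h2 := hz.2
          have h3 : ((2 * l + 1 : ℕ) : ℝ) + 1 ≤ (2 * l' : ℕ) := by
            exact_mod_cast (by omega : 2 * l + 1 + 1 ≤ 2 * l')
          refine (h2.trans_le (le_trans ?_ h1.le)).le
          gcongr
      obtain ⟨c', hc', hcval'⟩ := hval (A i)
      have hzero : I.value i (A i) = 0 := by
        rw [hcval' i]
        refine Finset.sum_eq_zero fun t _ => ?_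
        by_cases ht : t = 2 * l + 1
        · rw [(hc' t).2, mul_zero]
          rw [ht]
          exact (hA.disjoint i 0 (by simp [i, Fin.ext_iff])).mono_right hsub
        · rw [cellValue, if_neg (by simp [i]), if_neg, zero_mul]
          simp only [i]
          omega
      refine (I.egalitarianWelfare_le A i).trans ?_
      rw [hzero]
      positivity
    · refine (I.egalitarianWelfare_le A 0).trans ?_
      have hval0 : I.value 0 (A 0) =
          ∑ t ∈ Finset.range (2 * r + 1), cellValue m 0 t * c t := hcval 0
      rw [hval0]
      by_cases hall : ∃ t₀ ∈ Finset.range (2 * r + 1), cellValue m 0 t₀ * c t₀ ≠ 0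
      · have hform : ∀ t, cellValue m 0 t * c t ≠ 0 →
            cellValue m 0 t = 1 / (m : ℝ) ∧ ∃ l, t = 2 * l ∧ l < m ∧ c (2 * l) ≠ 0 := by
          intro t ht
          have h1 := left_ne_zero_of_mul ht
          rcases Nat.even_or_odd' t with ⟨l, rfl | rfl⟩
          · rw [cellValue_zero_two_mul] at h1 ⊢
            have hl : l < m := by
              by_contra hl
              exact h1 (if_neg hl)
            exact ⟨if_pos hl, l, rfl, hl, right_ne_zero_of_mul ht⟩
          · exact absurd (cellValue_zero_odd m l) h1
        obtain ⟨t₀, ht₀, hne⟩ := hall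
        obtain ⟨hv, l, hl, hlm, hcl⟩ := hform t₀ hne
        refine (Finset.sum_eq_single_of_mem t₀ ht₀ fun t _ htne => ?_).trans_le ?_
        · by_contra hne'
          obtain ⟨-, l', hl', hlm', hcl'⟩ := hform t hne'
          rcases lt_trichotomy l l' with hlt | heq | hlt
          · exact hcase ⟨l, l', hlt, hlm', hcl, hcl'⟩
          · exact htne (by rw [hl, hl', heq])
          · exact hcase ⟨l', l, hlt, hlm, hcl', hcl⟩
        · rw [hv]
          exact mul_le_of_le_one_right (by positivity) (hc t₀).1
      · push Not at hall
        rw [Finset.sum_eq_zero hall]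
        positivity
  have hden := I.one_div_le_optEgalitarianF hn le_rfl freeDisposal
  have hdpos : 0 < I.optEgalitarianF freeDisposal 1 := lt_of_lt_of_le (by positivity) hden
  rw [Instance.gainEF, le_div_iff₀ hdpos]
  calc (m : ℝ) * I.optEgalitarianF freeDisposal 1 ≤ m * (1 / m) := by gcongr
    _ = 1 := mul_one_div_cancel hmpos.ne'
    _ ≤ _ := hlow

end CakeCutting

end
-- The egalitarian price of indivisibility
theorem theorem3p22 (freeDisposal : Bool) (n k : ℕ) (hn : 1 ≤ n) (hk : 1 ≤ k) :
    -- the maxima in the numerator and in the denominator of the gain exist, and no gain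
    -- divides by zero
    (∀ I : CakeCutting.Instance n,
      IsGreatest (I.egalitarianWelfare '' I.allocationsF freeDisposal k)
        (I.optEgalitarianF freeDisposal k) ∧
      IsGreatest (I.egalitarianWelfare '' I.allocationsF freeDisposal 1)
        (I.optEgalitarianF freeDisposal 1) ∧
      0 < I.optEgalitarianF freeDisposal 1) ∧
    -- the supremum over all instances is finite
    BddAbove (Set.range fun I : CakeCutting.Instance n => I.gainEF freeDisposal k) ∧
    (k ≤ n →
      (k : ℝ) ≤ CakeCutting.POIEf freeDisposal n k ∧
      ∃ I : CakeCutting.Instance n, (k : ℝ) ≤ I.gainEF freeDisposal k) ∧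
    (n < k →
      CakeCutting.POIEf freeDisposal n k = n ∧
      ∃ I : CakeCutting.Instance n, I.gainEF freeDisposal k = n) := by
  have hnpos : (0 : ℝ) < n := by exact_mod_cast hn
  -- The real supremum defaults to `0` on unbounded sets, so comparing it with a single gain
  -- requires this bound.
  have hbdd : BddAbove (Set.range fun I : CakeCutting.Instance n => I.gainEF freeDisposal k) := by
    refine ⟨n, ?_⟩
    rintro _ ⟨I, rfl⟩
    exact I.gainEF_le hn hk freeDisposal
  refine ⟨fun I => ⟨I.isGreatest_optEgalitarianF hn hk freeDisposal,
    I.isGreatest_optEgalitarianF hn le_rfl freeDisposal,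
    lt_of_lt_of_le (by positivity) (I.one_div_le_optEgalitarianF hn le_rfl freeDisposal)⟩,
    hbdd, fun hkn => ?_, fun hnk => ?_⟩
  · obtain ⟨I, hI⟩ := CakeCutting.exists_instance_le_gainEF hk hkn le_rfl freeDisposal
    exact ⟨hI.trans (le_ciSup hbdd I), I, hI⟩
  · obtain ⟨I, hI⟩ := CakeCutting.exists_instance_le_gainEF hn le_rfl hnk.le freeDisposal
    have hle := fun I : CakeCutting.Instance n => I.gainEF_le hn hk freeDisposal
    have : Nonempty (CakeCutting.Instance n) := ⟨I⟩
    exact ⟨le_antisymm (ciSup_le hle) (hI.trans (le_ciSup hbdd I)), I, le_antisymm (hle I) hI⟩
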